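/- \textbf{Model (abstract Tile Assembly Model).} A \emph{tile system} $\Gamma=(T,\sigma,\tau)$ consists of a finite set $T$ of tile types (labelled unit squares, each side carrying a glue; every glue $g$ has a strength $\mathrm{str}(g)\in\mathbb{Z}_{\ge 0}$; tiles are not rotated), a temperature $\tau\in\mathbb{Z}_{>0}$, and a seed $\sigma$, a finite nonempty $\tau$-stable assembly. An \emph{assembly} places finitely many translated copies of tiles of $T$ on distinct cells of $\mathbb{Z}^2$. It is \emph{$\tau$-stable} if every cut of its bond graph has weight at least $\tau$, where two adjacent tiles are joined by an edge of weight $\mathrm{str}(g)$ if both carry the glue $g$ on their common side. The \emph{producible} assemblies are those obtained from $\sigma$ by successively adding single tiles on empty cells, every assembly on the way being $\tau$-stable; the \emph{frontier} of a producible assembly is the set of placed tiles that can be added in the next step; the set $\mathrm{TERM}_\Gamma$ of \emph{terminal} assemblies consists of the producible assemblies with empty frontier. A \emph{concentration distribution} on $T$ is a function $P:T\to(0,\infty)$ with $\sum_{t\in T}P(t)=1$. It makes the growth from $\sigma$ a Markov chain in which each tile in the frontier of the current assembly is added with probability equal to the concentration of its type divided by the sum of the concentrations of the types of all tiles in the frontier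 (counted with multiplicity). For $A\in\mathrm{TERM}_\Gamma$ let $\Pr^P[\Gamma\to A]$ be the probability that this chain ends in $A$. $\Gamma$ is a \emph{unidirectional two-choice linear assembly system} if for every producible assembly (i) all tiles in its frontier lie at one location (or the frontier is empty), (ii) its frontier has at most two elements, and (iii) it is a $1\times n$ line, i.e. its occupied cells are $n$ consecutive cells of one row, for some $n$. For an $m\times n$ block mapping $R$, which assigns to each tile type of $T$ a full $m\times n$ rectangle of tile types of $T'$, let $M_R(A)$ be the assembly obtained from an assembly $A$ over $T$ by replacing each tile, of type $t$ at $(x,y)$, by the tiles of types $R(t)(i,j)$ at $(mx+i,ny+j)$, $0\le i<m$, $0\le j<n$. A tile system $\Gamma'=(T',\sigma',\tau')$ \emph{robustly simulates $\Gamma=(T,\sigma,\tau)$ for the concentration distribution $P$ on $T$ at scale factor $m\times n$} if there is an $m\times n$ block mapping $R$ such that $M_R$ is a bijection from $\mathrm{TERM}_\Gamma$ onto $\mathrm{TERM}_{\Gamma'}$ and $$\Pr{}^{P}[\Gamma\to A]=\Pr{}^{C}[\Gamma'\to M_R(A)]$$ for all $A\in\mathrm{TERM}_\Gamma$ and all concentration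 distributions $C$ on $T'$. \textbf{Theorem.} For every unidirectional two-choice linear assembly system $\Gamma=(T,\sigma,2)$ there is a tile system $\Gamma_s=(T',\sigma',\tau')$ with $|T'|=20\,|T|$ that robustly simulates $\Gamma$ for the uniform concentration distribution on $T$ at scale factor $5\times 4$. -/

import Mathlib

open scoped ENNReal NNReal

namespace ATAM

/-- The four sides of a unit square tile. -/
inductive Side
  | north | east | south | west
  deriving DecidableEq

instance : Fintype Side where
  elems := {.north, .east, .south, .west}
  complete := by intro d; cases d <;> decide

/-- The opposite side. -/
def Side.opp : Side → Side
  | .north => .south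
  | .east => .west
  | .south => .north
  | .west => .east

/-- The unit vector pointing out of a side: the cell that faces side `d` of the cell `p` is
`p + d.vec`. -/
def Side.vec : Side → ℤ × ℤ
  | .north => (0, 1)
  | .east => (1, 0)
  | .south => (0, -1)
  | .west => (-1, 0)

/-- A (finite) assembly over the tile types `T`: finitely many cells of `ℤ²` are occupied, each by
one translated copy of a tile type. -/
@[ext]
structure Assembly (T : Type*) where
  cell : ℤ × ℤ → Option T
  finite_cells : {p | cell p ≠ none}.Finite

namespace Assembly

variable {T : Type*}

/-- The set of occupied cells. -/
noncomputable def dom (A : Assembly T) : Finset (ℤ × ℤ) := A.finite_cells.toFinset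

/-- The assembly `A ∪ {b}`, where `b` is the tile of type `t` at the cell `p`. (It is used only
for cells `p` that `A` leaves empty.) -/
def place (A : Assembly T) (p : ℤ × ℤ) (t : T) : Assembly T where
  cell := Function.update A.cell p (some t)
  finite_cells := by
    refine (A.finite_cells.insert p).subset ?_
    intro q hq
    by_cases h : q = p
    · exact Set.mem_insert_iff.mpr (Or.inl h)
    · refine Set.mem_insert_iff.mpr (Or.inr ?_)
      simpa [Function.update_of_ne h] using hq

/-- The assembly is a `1 × n` line: `n` consecutive cells of one row. -/
def IsLine (A : Assembly T) (n : ℕ) : Prop :=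
  ∃ x y : ℤ, ∀ p : ℤ × ℤ, p ∈ A.dom ↔ p.2 = y ∧ x ≤ p.1 ∧ p.1 < x + n

/-- Replace every tile of the assembly by an `m × n` block of tiles, according to the block
mapping `R`: a tile of type `t` at `(x, y)` becomes the tiles `R t i j` at
`(m x + i, n y + j)` for `0 ≤ i < m`, `0 ≤ j < n`. -/
def blockReplace {T' : Type*} {m n : ℕ} [NeZero m] [NeZero n] (R : T → Fin m → Fin n → T')
    (A : Assembly T) : Assembly T' where
  cell p := (A.cell (p.1 / m, p.2 / n)).map fun t =>
    R t (Fin.ofNat m (p.1 % m).toNat) (Fin.ofNat n (p.2 % n).toNat)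
  finite_cells := by
    have hm : (0 : ℤ) < m := by exact_mod_cast Nat.pos_of_neZero m
    have hn : (0 : ℤ) < n := by exact_mod_cast Nat.pos_of_neZero n
    refine ((A.finite_cells.prod (Set.finite_Ico (0 : ℤ) m |>.prod (Set.finite_Ico (0 : ℤ) n))).image
      (fun z : (ℤ × ℤ) × (ℤ × ℤ) => (m * z.1.1 + z.2.1, n * z.1.2 + z.2.2))).subset ?_
    intro p hp
    refine ⟨((p.1 / m, p.2 / n), (p.1 % m, p.2 % n)), ⟨?_, ?_, ?_⟩, ?_⟩
    · intro h
      apply hp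
      simp only at h
      simp [h]
    · exact ⟨Int.emod_nonneg _ hm.ne', Int.emod_lt_of_pos _ hm⟩
    · exact ⟨Int.emod_nonneg _ hn.ne', Int.emod_lt_of_pos _ hn⟩
    · exact Prod.ext (Int.mul_ediv_add_emod _ _) (Int.mul_ediv_add_emod _ _)

open Classical in
/-- The weight of the edge between the cells `p` and `q` in the bond graph of `A`: if both are
occupied and adjacent and the two tiles carry the same glue on their common edge, it is the
strength of that glue, and otherwise it is `0`. -/
noncomputable def bond {G : Type*} (glue : T → Side → G) (str : G → ℕ) (A : Assembly T)
    (p q : ℤ × ℤ) : ℕ :=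
  match A.cell p, A.cell q with
  | some a, some b =>
      ∑ d : Side, if q = p + d.vec ∧ glue a d = glue b d.opp then str (glue a d) else 0
  | _, _ => 0

/-- `τ`-stability: every cut of the bond graph into two nonempty parts has weight at least `τ`. -/
def Stable {G : Type*} (glue : T → Side → G) (str : G → ℕ) (τ : ℕ) (A : Assembly T) : Prop :=
  ∀ S ⊆ A.dom, S.Nonempty → S ≠ A.dom →
    τ ≤ ∑ p ∈ S, ∑ q ∈ A.dom \ S, A.bond glue str p q

end Assembly

/-- A tile system of the abstract Tile Assembly Model with the tile types `T` and the glue types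
`G`. Tile types with the same four glues may be distinct, as tiles may carry labels. -/
structure TileSystem (T G : Type*) where
  glue : T → Side → G
  str : G → ℕ
  seed : Assembly T
  temperature : ℕ
  temperature_pos : 0 < temperature
  seed_nonempty : seed.dom.Nonempty
  seed_stable : seed.Stable glue str temperature

/-- A concentration distribution over the tile types `T`. -/
structure Concentration (T : Type*) [Fintype T] where
  conc : T → ℝ≥0
  conc_pos : ∀ t, 0 < conc t
  sum_conc : ∑ t, conc t = 1

/-- The uniform concentration distribution. -/
noncomputable def Concentration.uniform (T : Type*) [Fintype T] [Nonempty T] :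
    Concentration T where
  conc _ := (Fintype.card T : ℝ≥0)⁻¹
  conc_pos _ := by
    have : (0 : ℝ≥0) < Fintype.card T := by exact_mod_cast Fintype.card_pos
    positivity
  sum_conc := by
    have : (Fintype.card T : ℝ≥0) ≠ 0 := by exact_mod_cast Fintype.card_ne_zero
    simp [Finset.sum_const, this]

namespace TileSystem

variable {T G : Type*} (Γ : TileSystem T G)

/-- The frontier of `A`: the tiles `(p, t)` (type `t` at the empty cell `p`) such that `A` with
this tile added is `τ`-stable. -/
def frontier (A : Assembly T) : Set ((ℤ × ℤ) × T) :=
  {b | A.cell b.1 = none ∧ (A.place b.1 b.2).Stable Γ.glue Γ.str Γ.temperature}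

/-- The producible assemblies. -/
inductive Producible : Assembly T → Prop
  | seed : Producible Γ.seed
  | attach {A : Assembly T} {p : ℤ × ℤ} {t : T} :
      Producible A → (p, t) ∈ Γ.frontier A → Producible (A.place p t)

/-- The terminal assemblies: the producible ones with empty frontier. -/
def terminal : Set (Assembly T) := {A | Γ.Producible A ∧ Γ.frontier A = ∅}

/-- `k`-extensibility: each producible assembly can grow in at most `k` locations. -/
def IsExtensible (k : ℕ) : Prop :=
  ∀ A, Γ.Producible A → (Prod.fst '' Γ.frontier A).encard ≤ k

/-- Unidirectional two-choice linear assembly systems. -/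
structure IsUnidirectionalTwoChoiceLinear : Prop where
  extensible : Γ.IsExtensible 1
  two_choice : ∀ A, Γ.Producible A → (Γ.frontier A).encard ≤ 2
  linear : ∀ A, Γ.Producible A → ∃ n, A.IsLine n

section Probability

variable [Fintype T]

open Classical in
/-- The probability of the transition from `A` to `B` by the attachment of a single tile: the
concentration of the attached tile type, divided by the sum of these concentrations over all
possible attachments to `A`. It is `0` if no single attachment leads from `A` to `B`, so in
particular if `A` is terminal. -/
noncomputable def trans (P : Concentration T) (A B : Assembly T) : ℝ≥0∞ :=
  (∑' b : Γ.frontier A, if A.place b.1.1 b.1.2 = B then (P.conc b.1.2 : ℝ≥0∞) else 0) /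
    ∑' b : Γ.frontier A, (P.conc b.1.2 : ℝ≥0∞)

open Classical in
/-- The probability that the assembly process, started at the seed, makes `n` attachments and is
at the assembly `A` after them. -/
noncomputable def probAfter (P : Concentration T) : ℕ → Assembly T → ℝ≥0∞
  | 0, A => if A = Γ.seed then 1 else 0
  | n + 1, B => ∑' A, probAfter P n A * Γ.trans P A B

/-- For terminal `A`, the probability that the process ends in `A`. The process can be at `A` for
at most one number `n` of attachments, and then stops there. -/
noncomputable def termProb (P : Concentration T) (A : Assembly T) : ℝ≥0∞ :=
  ∑' n, Γ.probAfter P n A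

/-- `Γ.RobustlySimulates Γ₀ P m n`: there is an `m × n` block mapping for which block replacement
is a bijection from the terminal assemblies of `Γ₀` onto those of `Γ`, and which carries the
probabilities of the terminal assemblies of `Γ₀` under `P` to those of `Γ` under every
concentration distribution over the tile types of `Γ`. -/
def RobustlySimulates {T₀ G₀ : Type*} [Fintype T₀] (Γ₀ : TileSystem T₀ G₀)
    (P : Concentration T₀) (m n : ℕ) [NeZero m] [NeZero n] : Prop :=
  ∃ R : T₀ → Fin m → Fin n → T,
    Set.BijOn (Assembly.blockReplace R) Γ₀.terminal Γ.terminal ∧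
    ∀ A ∈ Γ₀.terminal, ∀ C : Concentration T,
      Γ₀.termProb P A = Γ.termProb C (A.blockReplace R)

end Probability

end TileSystem

end ATAM

/-!
A linear system can grow only at one end of its line, and reflecting the plane exchanges the two
ends, so let it grow to the east. Each tile of type `t` is simulated by a `5 × 4` block whose glues
are so weak that the block can grow only from the exit of the block to its west, in one way up to
irrelevant reorderings.

The difficulty is a choice between two tile types `ρ` and `t`, as the concentrations in the
simulating system are arbitrary. The block starts with tiles that belong to the unordered pair,
named by its representative `ρ`, up to a trigger next to the cells of the tile types `heads` and
`tails`. Both cells are adjacent to one contested cell, to which each of the two types can also be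
attached. If `heads` is placed first, then `tails` is added, with probability `1 / 2`, to its own
cell or to the contested one, as both placements have the same tile type; and symmetrically. Once
the two cells are filled and the contested one is not, the biased coin is tossed again, with the
same bias. By von Neumann's trick the contested cell is decided fairly: either the second toss
repeats the law of the first, or the opposite of the first toss counts. The rest of the block
depends on the contested tile and stands for `ρ` or `t` accordingly. If there is no choice, a glue
keeps `tails` off the contested cell.
-/

namespace ATAM

/-! ### Bonds, cuts and attachments -/

theorem Side.opp_opp (d : Side) : d.opp.opp = d := by cases d <;> rfl

theorem Side.vec_opp (d : Side) : d.opp.vec = -d.vec := by cases d <;> rfl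

theorem Side.vec_ne_zero (d : Side) : d.vec ≠ 0 := by cases d <;> decide

theorem Side.vec_injective : Function.Injective Side.vec := by
  intro a b; cases a <;> cases b <;> decide

theorem Side.sum_eq {M : Type*} [AddCommMonoid M] (f : Side → M) :
    ∑ d : Side, f d = f .north + (f .east + (f .south + f .west)) := by
  change ∑ d ∈ {.north, .east, .south, .west}, f d = _
  rw [Finset.sum_insert (by decide), Finset.sum_insert (by decide), Finset.sum_insert (by decide),
    Finset.sum_singleton]

namespace Assembly

variable {T G : Type*}

section Place

variable {A : Assembly T} {p q : ℤ × ℤ}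

theorem mem_dom : p ∈ A.dom ↔ A.cell p ≠ none := by
  simp [dom]

variable (A) in
theorem cell_place_self (p : ℤ × ℤ) (t : T) : (A.place p t).cell p = some t := by
  simp [place]

theorem cell_place_of_ne (t : T) (h : q ≠ p) : (A.place p t).cell q = A.cell q := by
  simp [place, Function.update_of_ne h]

variable (A) in
theorem dom_place (p : ℤ × ℤ) (t : T) : (A.place p t).dom = insert p A.dom := by
  ext q
  rcases eq_or_ne q p with rfl | h
  · simp [mem_dom, cell_place_self]
  · simp [mem_dom, cell_place_of_ne t h, h]

theorem card_dom_place (t : T) (h : A.cell p = none) :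
    (A.place p t).dom.card = A.dom.card + 1 := by
  rw [dom_place, Finset.card_insert_of_notMem]
  simp [mem_dom, h]

theorem place_comm (s t : T) (h : p ≠ q) :
    (A.place p s).place q t = (A.place q t).place p s :=
  Assembly.ext (Function.update_comm h.symm _ _ _).symm

end Place

section Bond

variable (glue : T → Side → G) (str : G → ℕ) {A B : Assembly T} {p q : ℤ × ℤ}

open Classical in
/-- The strength of the bond that a tile of type `t` would form on its side `d` with the content of
the cell there. -/
noncomputable def bondWith (t : T) (d : Side) : Option T → ℕ
  | some a => if glue t d = glue a d.opp then str (glue t d) else 0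
  | none => 0

open Classical in
theorem bondWith_some (t : T) (d : Side) (a : T) :
    bondWith glue str t d (some a) = if glue t d = glue a d.opp then str (glue t d) else 0 :=
  rfl

theorem bondWith_none (t : T) (d : Side) : bondWith glue str t d none = 0 :=
  rfl

variable (A) in
/-- The total strength of the bonds that a tile of type `t` at the cell `p` would form with the
tiles of `A` on the four adjacent cells. -/
noncomputable def attachWeight (p : ℤ × ℤ) (t : T) : ℕ :=
  ∑ d : Side, bondWith glue str t d (A.cell (p + d.vec))

theorem attachWeight_place (s t : T) (h : ∀ d : Side, p + d.vec ≠ q) :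
    (A.place q s).attachWeight glue str p t = A.attachWeight glue str p t :=
  Finset.sum_congr rfl fun d _ => by rw [cell_place_of_ne _ (h d)]

theorem bond_eq_zero_of_notMem_dom (hq : q ∉ A.dom) : A.bond glue str p q = 0 := by
  rw [mem_dom, not_ne_iff] at hq
  unfold bond
  rw [hq]
  cases A.cell p <;> rfl

variable (A p q) in
theorem bond_comm : A.bond glue str p q = A.bond glue str q p := by
  unfold bond
  rcases A.cell p with _ | a <;> rcases A.cell q with _ | b <;> simp only
  refine Finset.sum_nbij' Side.opp Side.opp (by simp) (by simp)
    (fun d _ => d.opp_opp) (fun d _ => d.opp_opp) fun d _ => ?_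
  have hpq : q = p + d.vec ↔ p = q + d.opp.vec := by
    rw [Side.vec_opp]; constructor <;> rintro rfl <;> simp
  by_cases h : glue a d = glue b d.opp
  · simp [hpq, h, Side.opp_opp]
  · simp [h, Ne.symm h, Side.opp_opp]

theorem bond_congr (hp : A.cell p = B.cell p) (hq : A.cell q = B.cell q) :
    A.bond glue str p q = B.bond glue str p q := by
  unfold bond
  rw [hp, hq]

theorem bond_eq_sum_bondWith {a : T} (ha : A.cell p = some a) :
    A.bond glue str p q =
      ∑ d : Side, if q = p + d.vec then bondWith glue str a d (A.cell (p + d.vec)) else 0 := by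
  rcases hq : A.cell q with _ | b
  · rw [bond_eq_zero_of_notMem_dom _ _ (by simp [mem_dom, hq]),
      Finset.sum_eq_zero fun d _ => ?_]
    split_ifs with hd
    · rw [← hd, hq, bondWith_none]
    · rfl
  · unfold bond
    rw [ha, hq]
    refine Finset.sum_congr rfl fun d _ => ?_
    by_cases hd : q = p + d.vec
    · subst hd
      rw [if_pos rfl, hq, bondWith_some]
      congr 1
      simp
    · simp [hd]

theorem bond_add_vec {d : Side} {a : T} (ha : A.cell p = some a) :
    A.bond glue str p (p + d.vec) = bondWith glue str a d (A.cell (p + d.vec)) := by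
  simp only [bond_eq_sum_bondWith glue str ha, add_right_inj, Side.vec_injective.eq_iff,
    Finset.sum_ite_eq, Finset.mem_univ, if_true]

variable (A p) in
theorem sum_bond_place (t : T) :
    ∑ q ∈ A.dom, (A.place p t).bond glue str p q = A.attachWeight glue str p t := by
  simp only [bond_eq_sum_bondWith glue str (A.cell_place_self p t)]
  rw [Finset.sum_comm]
  refine Finset.sum_congr rfl fun d _ => ?_
  rw [Finset.sum_ite_eq', cell_place_of_ne _ (by simpa using d.vec_ne_zero)]
  split_ifs with hd
  · rfl
  · rw [mem_dom, not_ne_iff] at hd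
    rw [hd, bondWith_none]

end Bond

section Cut

variable {glue : T → Side → G} {str : G → ℕ} {τ : ℕ} {A : Assembly T} {S : Finset (ℤ × ℤ)}
  {p q p₁ q₁ p₂ q₂ : ℤ × ℤ}

variable (glue str A S) in
/-- The weight of the cut of the bond graph of `A` that separates the cells in `S` from the other
occupied cells. -/
noncomputable def cutWeight : ℕ :=
  ∑ p ∈ S, ∑ q ∈ A.dom \ S, A.bond glue str p q

theorem stable_iff_le_cutWeight : A.Stable glue str τ ↔
    ∀ S ⊆ A.dom, S.Nonempty → S ≠ A.dom → τ ≤ A.cutWeight glue str S :=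
  Iff.rfl

theorem cutWeight_dom : A.cutWeight glue str A.dom = 0 := by
  simp [cutWeight]

theorem cutWeight_dom_sdiff (hS : S ⊆ A.dom) :
    A.cutWeight glue str (A.dom \ S) = A.cutWeight glue str S := by
  rw [cutWeight, cutWeight, Finset.sdiff_sdiff_eq_self hS, Finset.sum_comm]
  exact Finset.sum_congr rfl fun p _ => Finset.sum_congr rfl fun q _ => bond_comm ..

theorem cutWeight_place (hS : S ⊆ A.dom) (hp : A.cell p = none) (t : T) :
    (A.place p t).cutWeight glue str S =
      A.cutWeight glue str S + ∑ q ∈ S, (A.place p t).bond glue str p q := by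
  have hpA : p ∉ A.dom := by simp [mem_dom, hp]
  have hcell : ∀ q ∈ A.dom, (A.place p t).cell q = A.cell q := fun q hq =>
    cell_place_of_ne _ (ne_of_mem_of_not_mem hq hpA)
  rw [cutWeight, cutWeight, ← Finset.sum_add_distrib]
  refine Finset.sum_congr rfl fun q hq => ?_
  rw [dom_place, Finset.insert_sdiff_of_notMem _ fun h => hpA (hS h),
    Finset.sum_insert (by simp [hpA]), add_comm, bond_comm]
  congr 1
  exact Finset.sum_congr rfl fun r hr =>
    bond_congr _ _ (hcell q (hS hq)) (hcell r (Finset.mem_sdiff.1 hr).1)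

/-- Attaching a tile to a stable assembly creates only one new kind of cut, the one that cuts off
the new tile. -/
theorem place_stable_iff (hA : A.Stable glue str τ) (hne : A.dom.Nonempty) (hp : A.cell p = none)
    (t : T) : (A.place p t).Stable glue str τ ↔ τ ≤ A.attachWeight glue str p t := by
  have hpA : p ∉ A.dom := by simp [mem_dom, hp]
  have cut_dom : (A.place p t).cutWeight glue str A.dom = A.attachWeight glue str p t := by
    rw [cutWeight_place subset_rfl hp, cutWeight_dom, zero_add, sum_bond_place]
  rw [stable_iff_le_cutWeight]
  constructor
  · intro h
    rw [← cut_dom]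
    refine h _ ?_ hne ?_ <;> rw [dom_place]
    · exact Finset.subset_insert _ _
    · exact fun e => hpA (e ▸ Finset.mem_insert_self _ _)
  · intro hw S hS hSne hSdom
    wlog hpS : p ∉ S generalizing S
    · rw [← cutWeight_dom_sdiff hS]
      refine this _ Finset.sdiff_subset ?_ ?_ (by simpa using fun _ => not_not.1 hpS)
      · exact Finset.sdiff_nonempty.2 fun h => hSdom (hS.antisymm h)
      · rw [Ne, Finset.sdiff_eq_self_iff_disjoint]
        obtain ⟨q, hq⟩ := hSne
        exact fun h => Finset.disjoint_left.1 h (hS hq) hq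
    have hSA : S ⊆ A.dom := (Finset.subset_insert_iff_of_notMem hpS).1 (dom_place A p t ▸ hS)
    rcases eq_or_ne S A.dom with rfl | hSA'
    · rwa [cut_dom]
    · rw [cutWeight_place hSA hp]
      exact (hA S hSA hSne hSA').trans (Nat.le_add_right _ _)

theorem sum_bond_le_cutWeight {E : Finset ((ℤ × ℤ) × (ℤ × ℤ))}
    (hE : ∀ e ∈ E, e.1 ∈ S ∧ e.2 ∉ S) :
    ∑ e ∈ E, A.bond glue str e.1 e.2 ≤ A.cutWeight glue str S := by
  rw [cutWeight, ← Finset.sum_product',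
    ← Finset.sum_filter_of_ne (s := E) (p := fun e => e.2 ∈ A.dom) fun e _ he =>
      not_imp_comm.1 (bond_eq_zero_of_notMem_dom glue str) he]
  refine Finset.sum_le_sum_of_subset fun e he => ?_
  obtain ⟨he, hdom⟩ := Finset.mem_filter.1 he
  exact Finset.mem_product.2 ⟨(hE e he).1, Finset.mem_sdiff.2 ⟨hdom, (hE e he).2⟩⟩

theorem mem_iff_of_cutWeight_lt (h : A.cutWeight glue str S < A.bond glue str p q) :
    p ∈ S ↔ q ∈ S := by
  by_contra hpq
  wlog hp : p ∈ S generalizing p q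
  · exact this (bond_comm glue str A p q ▸ h) (fun h => hpq h.symm) (by tauto)
  have := sum_bond_le_cutWeight (A := A) (glue := glue) (str := str) (E := {(p, q)})
    (S := S) (by simp; tauto)
  rw [Finset.sum_singleton] at this
  exact this.not_gt h

theorem mem_iff_or_mem_iff_of_cutWeight_lt
    (h : A.cutWeight glue str S < A.bond glue str p₁ q₁ + A.bond glue str p₂ q₂)
    (hne : s(p₁, q₁) ≠ s(p₂, q₂)) : (p₁ ∈ S ↔ q₁ ∈ S) ∨ (p₂ ∈ S ↔ q₂ ∈ S) := by
  by_contra! hcross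
  wlog hp₁ : p₁ ∈ S generalizing p₁ q₁
  · exact this (bond_comm glue str A p₁ q₁ ▸ h) (Sym2.eq_swap ▸ hne) (by tauto) (by tauto)
  wlog hp₂ : p₂ ∈ S generalizing p₂ q₂
  · exact this (bond_comm glue str A p₂ q₂ ▸ h) (Sym2.eq_swap (a := q₂) ▸ hne) (by tauto) (by tauto)
  have hpair : (p₁, q₁) ≠ (p₂, q₂) := fun e => hne (by rw [Prod.mk.injEq] at e; rw [e.1, e.2])
  have := sum_bond_le_cutWeight (A := A) (glue := glue) (str := str)
    (E := {(p₁, q₁), (p₂, q₂)}) (S := S) (by simp; tauto)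
  rw [Finset.sum_pair hpair] at this
  exact this.not_gt h

end Cut

end Assembly

/-! ### The growth process -/

theorem Concentration.coe_conc_ne_zero {T : Type*} [Fintype T] (P : Concentration T) (t : T) :
    (P.conc t : ℝ≥0∞) ≠ 0 := by
  simpa using (P.conc_pos t).ne'

namespace TileSystem

variable {T G : Type*} {Γ : TileSystem T G} {A X : Assembly T} {p q : ℤ × ℤ} {s t : T}

section Frontier

theorem Producible.stable (h : Γ.Producible A) : A.Stable Γ.glue Γ.str Γ.temperature := by
  cases h with
  | seed => exact Γ.seed_stable
  | attach _ hf => exact hf.2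

theorem Producible.nonempty (h : Γ.Producible A) : A.dom.Nonempty := by
  cases h with
  | seed => exact Γ.seed_nonempty
  | attach _ hf => rw [Assembly.dom_place]; exact Finset.insert_nonempty _ _

theorem Producible.mem_frontier_iff (h : Γ.Producible A) :
    (p, t) ∈ Γ.frontier A ↔
      A.cell p = none ∧ Γ.temperature ≤ A.attachWeight Γ.glue Γ.str p t :=
  and_congr_right fun hp => Assembly.place_stable_iff h.stable h.nonempty hp t

theorem Producible.frontier_finite [Finite T] (h : Γ.Producible A) : (Γ.frontier A).Finite := by
  classical
  refine (((A.dom ×ˢ (Finset.univ : Finset Side)).image fun x => x.1 - x.2.vec).finite_toSet.prod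
    (Set.finite_univ (α := T))).subset ?_
  rintro ⟨p, t⟩ hpt
  have hpos := Γ.temperature_pos.trans_le (h.mem_frontier_iff.1 hpt).2
  obtain ⟨d, -, hd⟩ := Finset.exists_ne_zero_of_sum_ne_zero hpos.ne'
  refine ⟨Finset.mem_coe.2 <| Finset.mem_image.2 ⟨(p + d.vec, d), Finset.mem_product.2
    ⟨Assembly.mem_dom.2 fun hnone => hd ?_, Finset.mem_univ d⟩, by simp⟩, trivial⟩
  rw [hnone, Assembly.bondWith_none]

theorem Producible.mem_frontier_place_iff (h : Γ.Producible A) (hqs : (q, s) ∈ Γ.frontier A)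
    (hne : p ≠ q) (hadj : ∀ d : Side, p + d.vec ≠ q) :
    (p, t) ∈ Γ.frontier (A.place q s) ↔ (p, t) ∈ Γ.frontier A := by
  rw [(h.attach hqs).mem_frontier_iff, h.mem_frontier_iff, Assembly.cell_place_of_ne _ hne,
    Assembly.attachWeight_place _ _ _ _ hadj]

theorem notMem_frontier_place_self : (p, s) ∉ Γ.frontier (A.place p t) := fun h => by
  simpa [Assembly.cell_place_self] using h.1

theorem Producible.frontier_eq_insert_of_enclosed (h : Γ.Producible A)
    (hpt : (p, t) ∈ Γ.frontier A) (huniq : ∀ t', (p, t') ∈ Γ.frontier A → t' = t)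
    (henc : ∀ d : Side, A.cell (p + d.vec) ≠ none) :
    Γ.frontier A = insert (p, t) (Γ.frontier (A.place p t)) := by
  ext ⟨q, s⟩
  rcases eq_or_ne q p with rfl | hqp
  · simpa [notMem_frontier_place_self] using ⟨huniq s, by rintro rfl; exact hpt⟩
  by_cases hq : A.cell q = none
  · rw [Set.mem_insert_iff, Prod.mk.injEq, h.mem_frontier_place_iff hpt hqp]
    · simp [hqp]
    · rintro d rfl
      exact henc d.opp (by simpa [Side.vec_opp] using hq)
  · have hq' : (A.place p t).cell q ≠ none := by rwa [Assembly.cell_place_of_ne _ hqp]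
    exact iff_of_false (fun hs => hq hs.1) (by
      rintro (hs | hs)
      exacts [hqp (congrArg Prod.fst hs), hq' hs.1])

end Frontier

section Probability

variable [Fintype T] {P : Concentration T} {f : Assembly T → ℝ≥0∞}

section Step

theorem tsum_conc_ne_zero {F : Set ((ℤ × ℤ) × T)} (hF : F.Nonempty) :
    ∑' b : F, (P.conc b.1.2 : ℝ≥0∞) ≠ 0 := by
  obtain ⟨b, hb⟩ := hF
  exact fun h => P.coe_conc_ne_zero b.2 (ENNReal.tsum_eq_zero.1 h ⟨b, hb⟩)

theorem tsum_conc_ne_top {F : Set ((ℤ × ℤ) × T)} (hF : F.Finite) :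
    ∑' b : F, (P.conc b.1.2 : ℝ≥0∞) ≠ ⊤ := by
  have := hF.fintype
  rw [tsum_fintype]
  exact ENNReal.sum_ne_top.2 fun _ _ => ENNReal.coe_ne_top

/-- The expected value of `f` after one attachment to `A`; it is `0` if nothing attaches to `A`. -/
noncomputable def step (Γ : TileSystem T G) (P : Concentration T) (f : Assembly T → ℝ≥0∞)
    (A : Assembly T) : ℝ≥0∞ :=
  (∑' b : Γ.frontier A, (P.conc b.1.2 : ℝ≥0∞) * f (A.place b.1.1 b.1.2)) /
    ∑' b : Γ.frontier A, (P.conc b.1.2 : ℝ≥0∞)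

variable (P A f) in
theorem tsum_trans_mul : ∑' B, Γ.trans P A B * f B = Γ.step P f A := by
  classical
  simp only [trans, step, div_eq_mul_inv]
  simp_rw [mul_right_comm, ENNReal.tsum_mul_right, ← ENNReal.tsum_mul_right (a := f _)]
  rw [ENNReal.tsum_comm]
  congr 2
  funext b
  rw [tsum_eq_single (A.place b.1.1 b.1.2) fun B hB => by rw [if_neg hB.symm, zero_mul],
    if_pos rfl]

theorem step_of_frontier_eq_empty (h : Γ.frontier A = ∅) : Γ.step P f A = 0 := by
  have : IsEmpty (Γ.frontier A) := by rw [h]; infer_instance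
  simp [step]

theorem step_congr {g : Assembly T → ℝ≥0∞}
    (h : ∀ p t, (p, t) ∈ Γ.frontier A → f (A.place p t) = g (A.place p t)) :
    Γ.step P f A = Γ.step P g A := by
  unfold step
  congr 1
  exact tsum_congr fun b => by rw [h _ _ b.2]

theorem step_singleton {b : (ℤ × ℤ) × T} (h : Γ.frontier A = {b}) :
    Γ.step P f A = f (A.place b.1 b.2) := by
  unfold step
  rw [h, tsum_singleton b (fun b => (P.conc b.2 : ℝ≥0∞) * f (A.place b.1 b.2)),
    tsum_singleton b (fun b => (P.conc b.2 : ℝ≥0∞)), mul_comm, mul_div_assoc,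
    ENNReal.div_self (P.coe_conc_ne_zero _) ENNReal.coe_ne_top, mul_one]

theorem step_pair {b c : (ℤ × ℤ) × T} (hbc : b ≠ c) (h : Γ.frontier A = {b, c}) :
    Γ.step P f A =
      P.conc b.2 / (P.conc b.2 + P.conc c.2) * f (A.place b.1 b.2) +
      P.conc c.2 / (P.conc b.2 + P.conc c.2) * f (A.place c.1 c.2) := by
  classical
  unfold step
  have hcoe : ({b, c} : Set ((ℤ × ℤ) × T)) = (({b, c} : Finset ((ℤ × ℤ) × T)) : Set _) := by simp
  rw [h, hcoe, Finset.tsum_subtype' {b, c} (fun b => (P.conc b.2 : ℝ≥0∞) * f (A.place b.1 b.2)),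
    Finset.tsum_subtype' {b, c} (fun b => (P.conc b.2 : ℝ≥0∞)),
    Finset.sum_pair hbc, Finset.sum_pair hbc]
  simp only [div_eq_mul_inv]
  ring

theorem step_eq_of_tsum_eq {v : ℝ≥0∞} (hA : Γ.Producible A) (hne : (Γ.frontier A).Nonempty)
    (h : ∑' b : Γ.frontier A, (P.conc b.1.2 : ℝ≥0∞) * f (A.place b.1.1 b.1.2) =
      (∑' b : Γ.frontier A, (P.conc b.1.2 : ℝ≥0∞)) * v) : Γ.step P f A = v := by
  rw [step, h, mul_comm, mul_div_assoc,
    ENNReal.div_self (tsum_conc_ne_zero hne) (tsum_conc_ne_top hA.frontier_finite), mul_one]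

theorem step_const {v : ℝ≥0∞} (hA : Γ.Producible A) (hne : (Γ.frontier A).Nonempty)
    (h : ∀ p t, (p, t) ∈ Γ.frontier A → f (A.place p t) = v) : Γ.step P f A = v := by
  refine step_eq_of_tsum_eq hA hne ?_
  rw [← ENNReal.tsum_mul_right]
  exact tsum_congr fun b => by rw [h _ _ b.2]

end Step

section Hit

open Classical in
/-- The probability to be at `X` after `n` attachments to a given assembly. -/
noncomputable def walk (Γ : TileSystem T G) (P : Concentration T) (X : Assembly T) :
    ℕ → Assembly T → ℝ≥0∞
  | 0 => fun A => if A = X then 1 else 0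
  | n + 1 => Γ.step P (walk Γ P X n)

variable (P X) in
theorem tsum_probAfter_mul_walk (k n : ℕ) :
    ∑' A, Γ.probAfter P n A * Γ.walk P X k A = Γ.probAfter P (n + k) X := by
  classical
  induction k generalizing n with
  | zero =>
    simp only [walk, mul_ite, mul_one, mul_zero, add_zero]
    exact tsum_ite_eq X _
  | succ k ih =>
    simp_rw [walk, ← tsum_trans_mul, ← ENNReal.tsum_mul_left, ← mul_assoc]
    rw [ENNReal.tsum_comm]
    simp_rw [ENNReal.tsum_mul_right]
    exact (ih (n + 1)).trans (by rw [Nat.succ_add_eq_add_succ])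

/-- The probability that the growth from `A` passes through `X`. -/
noncomputable def hit (Γ : TileSystem T G) (P : Concentration T) (X A : Assembly T) : ℝ≥0∞ :=
  ∑' n, Γ.walk P X n A

variable (P X) in
theorem termProb_eq_hit : Γ.termProb P X = Γ.hit P X Γ.seed := by
  classical
  refine tsum_congr fun n => ?_
  rw [← Nat.zero_add n, ← tsum_probAfter_mul_walk, Nat.zero_add]
  simp only [probAfter, ite_mul, one_mul, zero_mul]
  exact tsum_ite_eq Γ.seed _

open Classical in
variable (P X A) in
theorem hit_eq_ite_add_step :
    Γ.hit P X A = (if A = X then 1 else 0) + Γ.step P (Γ.hit P X) A := by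
  rw [hit, tsum_eq_zero_add' ENNReal.summable, walk]
  congr 1
  simp only [walk, step, hit, div_eq_mul_inv, ENNReal.tsum_mul_right, ← ENNReal.tsum_mul_left]
  rw [ENNReal.tsum_comm]

theorem hit_eq_step (hX : Γ.frontier X = ∅) (hA : (Γ.frontier A).Nonempty) :
    Γ.hit P X A = Γ.step P (Γ.hit P X) A := by
  rw [hit_eq_ite_add_step, if_neg, zero_add]
  rintro rfl
  exact hA.ne_empty hX

theorem hit_of_frontier_eq_empty (hA : Γ.frontier A = ∅) (hne : A ≠ X) : Γ.hit P X A = 0 := by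
  rw [hit_eq_ite_add_step, if_neg hne, step_of_frontier_eq_empty hA, zero_add]

theorem hit_self_of_frontier_eq_empty (hA : Γ.frontier A = ∅) : Γ.hit P A A = 1 := by
  rw [hit_eq_ite_add_step, if_pos rfl, step_of_frontier_eq_empty hA, add_zero]

theorem walk_eq_zero_of_card_lt (n : ℕ) (h : X.dom.card < A.dom.card) : Γ.walk P X n A = 0 := by
  induction n generalizing A with
  | zero =>
    refine if_neg ?_
    rintro rfl
    exact lt_irrefl _ h
  | succ n ih =>
    rw [walk, step, ENNReal.div_eq_zero_iff, ENNReal.tsum_eq_zero]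
    refine Or.inl fun b => ?_
    rw [ih (by rw [Assembly.card_dom_place _ b.2.1]; omega), mul_zero]

theorem hit_eq_zero_of_card_lt (h : X.dom.card < A.dom.card) : Γ.hit P X A = 0 := by
  simp [hit, walk_eq_zero_of_card_lt _ h]

theorem hit_ne_zero_of_attach (hA : Γ.Producible A) (hpt : (p, t) ∈ Γ.frontier A)
    (h : Γ.hit P X (A.place p t) ≠ 0) : Γ.hit P X A ≠ 0 := by
  rw [hit_eq_ite_add_step]
  intro hzero
  have hstep := (add_eq_zero.1 hzero).2
  rw [step, ENNReal.div_eq_zero_iff] at hstep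
  rcases hstep with hsum | htop
  · exact mul_ne_zero (P.coe_conc_ne_zero t) h (ENNReal.tsum_eq_zero.1 hsum ⟨(p, t), hpt⟩)
  · exact tsum_conc_ne_top hA.frontier_finite htop

variable (P) in
theorem Producible.hit_seed_ne_zero (hX : Γ.Producible X) : Γ.hit P X Γ.seed ≠ 0 := by
  suffices ∀ Y, Γ.Producible Y → Γ.hit P X Y ≠ 0 → Γ.hit P X Γ.seed ≠ 0 from
    this X hX (by simp [hit_eq_ite_add_step])
  intro Y hY
  induction hY with
  | seed => exact id
  | attach hA hf ih => exact fun h => ih (hit_ne_zero_of_attach hA hf h)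

end Hit

section Enclosed

theorem tsum_conc_mul_hit_place (hX : Γ.frontier X = ∅) (hA : Γ.Producible A) :
    ∑' b : Γ.frontier A, (P.conc b.1.2 : ℝ≥0∞) * Γ.hit P X (A.place b.1.1 b.1.2) =
      (∑' b : Γ.frontier A, (P.conc b.1.2 : ℝ≥0∞)) * Γ.hit P X A := by
  rcases (Γ.frontier A).eq_empty_or_nonempty with hempty | hne
  · have : IsEmpty (Γ.frontier A) := by rw [hempty]; infer_instance
    simp
  · rw [hit_eq_step hX hne, step,
      ENNReal.mul_div_cancel (tsum_conc_ne_zero hne) (tsum_conc_ne_top hA.frontier_finite)]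

/-- A tile that will be attached at an empty cell with four occupied neighbours may as well be
attached at once: no later attachment depends on it, and it delays none. -/
theorem hit_place_of_enclosed (hX : Γ.frontier X = ∅) (hA : Γ.Producible A)
    (hpt : (p, t) ∈ Γ.frontier A) (huniq : ∀ t', (p, t') ∈ Γ.frontier A → t' = t)
    (henc : ∀ d : Side, A.cell (p + d.vec) ≠ none) :
    Γ.hit P X A = Γ.hit P X (A.place p t) := by
  obtain ⟨k, hk⟩ : ∃ k, X.dom.card + 1 ≤ A.dom.card + k := ⟨X.dom.card + 1, by omega⟩
  induction k generalizing A with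
  | zero =>
    rw [hit_eq_zero_of_card_lt (by omega), hit_eq_zero_of_card_lt]
    rw [Assembly.card_dom_place _ hpt.1]; omega
  | succ k ih =>
    have hF := hA.frontier_eq_insert_of_enclosed hpt huniq henc
    have hcomm : ∀ b : Γ.frontier (A.place p t), Γ.hit P X (A.place b.1.1 b.1.2) =
        Γ.hit P X ((A.place p t).place b.1.1 b.1.2) := by
      rintro ⟨⟨q, s⟩, hqs⟩
      have hq : (q, s) ∈ Γ.frontier A := hF ▸ Set.mem_insert_of_mem _ hqs
      have hpq : p ≠ q := by rintro rfl; exact notMem_frontier_place_self hqs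
      have hiff : ∀ t', (p, t') ∈ Γ.frontier (A.place q s) ↔ (p, t') ∈ Γ.frontier A := fun t' =>
        hA.mem_frontier_place_iff hq hpq fun d hd => henc d (hd ▸ hq.1)
      rw [Assembly.place_comm _ _ hpq]
      refine ih (hA.attach hq) ((hiff t).2 hpt) (fun t' h => huniq t' ((hiff t').1 h)) ?_ ?_
      · exact fun d => Assembly.mem_dom.1 <| by
          simp [Assembly.dom_place, Assembly.mem_dom.2 (henc d)]
      · rw [Assembly.card_dom_place _ hq.1]; omega
    have hsum : ∀ g : (ℤ × ℤ) × T → ℝ≥0∞,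
        ∑' b : Γ.frontier A, g b = g (p, t) + ∑' b : Γ.frontier (A.place p t), g b := fun g => by
      rw [hF, Set.insert_eq, ENNReal.summable.tsum_union_disjoint
        (Set.disjoint_singleton_left.2 notMem_frontier_place_self) ENNReal.summable,
        tsum_singleton (p, t) g]
    rw [hit_eq_step hX ⟨_, hpt⟩]
    refine step_eq_of_tsum_eq hA ⟨_, hpt⟩ ?_
    rw [hsum fun b => P.conc b.2 * Γ.hit P X (A.place b.1 b.2), hsum fun b => P.conc b.2, add_mul,
      ← tsum_conc_mul_hit_place hX (hA.attach hpt)]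
    simp only [hcomm]

end Enclosed

end Probability

end TileSystem

/-! ### The blocks of the simulating system -/

/-- The cells of a `5 × 4` block. The tile types of the simulating system are pairs of a datum and
a role, where the roles are named after the cells of a block. -/
abbrev Role : Type := Fin 5 × Fin 4

namespace Role

/-- Position of a side in the rows of `labelTable`. -/
def sideIndex : Side → ℕ
  | .north => 0
  | .east => 1
  | .south => 2
  | .west => 3

/-- The glue labels of the roles, by columns from left to right, and from bottom to top in each
column; the four labels of a role are those on the sides north, east, south, west. The labels below
`20` have strength `1` and the others have strength `2`, except for the label `0` of strength `0`.

A block grows from its upper left corner along the early path `(0,3)`, `(1,3)`, `(2,3)`, `(3,3)`,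
`(3,2)`, `(3,1)`, `(2,1)`, `(2,2)`, `(1,2)`, whose last cell is the trigger of the coin flip. Then
the cells `(0,2)`, `(1,1)` and `(0,1)` are filled, of which the last decides on the cell `(0,0)`,
the first one of the late path `(0,0)`, `(1,0)`, `(2,0)`, `(3,0)`, `(4,0)`, `(4,1)`, `(4,2)`,
`(4,3)`. -/
def labelTable : List (List ℕ) :=
  [[4, 8, 0, 7], [0, 0, 0, 0], [1, 3, 4, 3], [0, 21, 1, 20],
   [4, 29, 0, 8], [4, 2, 4, 3], [0, 28, 4, 3], [0, 22, 0, 21],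
   [0, 30, 0, 29], [27, 26, 0, 2], [0, 0, 27, 28], [0, 23, 0, 22],
   [0, 31, 0, 30], [25, 0, 0, 26], [24, 0, 25, 0], [0, 0, 24, 23],
   [32, 7, 0, 31], [33, 3, 32, 0], [34, 0, 33, 0], [0, 20, 34, 0]]

/-- The glue label on a side of a role. -/
def label (r : Role) (d : Side) : ℕ :=
  (labelTable.getD (4 * r.1 + r.2) []).getD (sideIndex d) 0

/-- The strength of a glue label. -/
def labelStr (l : ℕ) : ℕ := if l = 0 then 0 else if l < 20 then 1 else 2

/-- The role of the tile to the west of the trigger, which may also be attached to the contested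
cell. -/
abbrev heads : Role := (0, 2)

/-- The role of the tile to the south of the trigger, which may also be attached to the contested
cell. -/
abbrev tails : Role := (1, 1)

/-- The cell of a block at which `heads` and `tails` compete. -/
abbrev contested : Role := (0, 1)

/-- The cells that are filled, by a path of tiles, after the coin flip. -/
def IsLate (r : Role) : Bool := r.2 = 0 || r.1 = 4

/-- The rank of a cell on the path before the coin flip or on the path after it. -/
def rank (r : Role) : ℕ :=
  ([0, 0, 0, 0, 1, 0, 8, 1, 2, 6, 7, 2, 3, 5, 4, 3, 4, 5, 6, 7] : List ℕ).getD (4 * r.1 + r.2) 0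

/-- The role of the tile at an occupied cell of a block, where `z` is the role of the tile at the
contested cell. -/
def roleAt (z r : Role) : Role := if r = contested then z else r

/-- In a block, a tile of role `s` may lie at the cell `r`. -/
def Accepts (r s : Role) : Prop := s = r ∨ r = contested ∧ (s = heads ∨ s = tails)

instance : DecidableRel Accepts := fun r s => by unfold Accepts; infer_instance

theorem accepts_roleAt {z : Role} (hz : z = heads ∨ z = tails) (r : Role) :
    Accepts r (roleAt z r) := by
  unfold Accepts roleAt
  split_ifs with h
  · exact Or.inr ⟨h, hz⟩
  · exact Or.inl rfl

theorem label_north_eq_zero {r s : Role} (h : Accepts r s) (hr : r.2 = 3) :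
    label s .north = 0 := by
  revert r s; decide +kernel

theorem label_south_eq_zero {r s : Role} (h : Accepts r s) (hr : r.2 = 0) :
    label s .south = 0 := by
  revert r s; decide +kernel

theorem labelStr_east_le_one {r s : Role} (h : Accepts r s) (hr : r.1 = 4) (hr' : r.2 ≠ 3) :
    labelStr (label s .east) ≤ 1 := by
  revert r s; decide +kernel

theorem labelStr_west_le_one {r s : Role} (h : Accepts r s) (hr : r.1 = 0) (hr' : r.2 ≠ 3) :
    labelStr (label s .west) ≤ 1 := by
  revert r s; decide +kernel

theorem eq_exit_of_label_east {s : Role} (h : label s .east = 20) : s = (4, 3) := by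
  revert s; decide +kernel

end Role

open Role

/-- The cell `r` of the `5 × 4` block `q` of the plane. -/
def blockCell (q : ℤ × ℤ) (r : Role) : ℤ × ℤ := (5 * q.1 + r.1.val, 4 * q.2 + r.2.val)

/-- The position of a cell of the plane in its block. -/
def roleOf (p : ℤ × ℤ) : Role := (Fin.ofNat 5 (p.1 % 5).toNat, Fin.ofNat 4 (p.2 % 4).toNat)

/-- The block of a cell of the plane. -/
def blockOf (p : ℤ × ℤ) : ℤ × ℤ := (p.1 / 5, p.2 / 4)

theorem blockOf_blockCell (q : ℤ × ℤ) (r : Role) : blockOf (blockCell q r) = q := by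
  obtain ⟨x, y⟩ := q
  obtain ⟨i, j⟩ := r
  simp only [blockOf, blockCell, Prod.mk.injEq]
  omega

theorem roleOf_blockCell (q : ℤ × ℤ) (r : Role) : roleOf (blockCell q r) = r := by
  obtain ⟨x, y⟩ := q
  obtain ⟨i, j⟩ := r
  simp only [roleOf, blockCell, Prod.mk.injEq, Fin.ext_iff, Fin.ofNat]
  omega

theorem blockCell_blockOf_roleOf (p : ℤ × ℤ) : blockCell (blockOf p) (roleOf p) = p := by
  obtain ⟨x, y⟩ := p
  simp only [roleOf, blockOf, blockCell, Prod.mk.injEq, Fin.ofNat]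
  omega

theorem blockCell_inj {q q' : ℤ × ℤ} {r r' : Role} :
    blockCell q r = blockCell q' r' ↔ q = q' ∧ r = r' := by
  refine ⟨fun h => ⟨?_, ?_⟩, by rintro ⟨rfl, rfl⟩; rfl⟩
  · simpa only [blockOf_blockCell] using congrArg blockOf h
  · simpa only [roleOf_blockCell] using congrArg roleOf h

namespace Assembly

theorem cell_blockReplace {T T' : Type*} (R : T → Fin 5 → Fin 4 → T') (A : Assembly T)
    (q : ℤ × ℤ) (r : Role) :
    (A.blockReplace R).cell (blockCell q r) = (A.cell q).map fun t => R t r.1 r.2 := by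
  have hblock := blockOf_blockCell q r
  obtain ⟨hcol, hrow⟩ := Prod.ext_iff.1 (roleOf_blockCell q r)
  simp only [blockOf, roleOf] at hblock hcol hrow
  simp only [blockReplace, Nat.cast_ofNat, hblock, hcol, hrow]

/-- The assembly `B` with the contents of the block `q` replaced by `m`. -/
def fill {T : Type*} (B : Assembly T) (q : ℤ × ℤ) (m : Role → Option T) : Assembly T where
  cell p := if blockOf p = q then m (roleOf p) else B.cell p
  finite_cells := by
    refine (B.finite_cells.union (Set.finite_range (blockCell q))).subset fun p hp => ?_
    by_cases h : blockOf p = q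
    · exact Or.inr ⟨roleOf p, by rw [← h, blockCell_blockOf_roleOf]⟩
    · exact Or.inl (by simpa [h] using hp)

variable {T : Type*} (B : Assembly T) (q : ℤ × ℤ) (m : Role → Option T)

theorem cell_fill (r : Role) : (B.fill q m).cell (blockCell q r) = m r := by
  simp [fill, blockOf_blockCell, roleOf_blockCell]

theorem cell_fill_of_ne {q' : ℤ × ℤ} (h : q' ≠ q) (r : Role) :
    (B.fill q m).cell (blockCell q' r) = B.cell (blockCell q' r) := by
  simp [fill, blockOf_blockCell, h]

theorem ext_blockCell {A B : Assembly T}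
    (h : ∀ q r, A.cell (blockCell q r) = B.cell (blockCell q r)) : A = B := by
  ext1
  funext p
  rw [← blockCell_blockOf_roleOf p]
  exact h _ _

theorem fill_place {m m' : Role → Option T} {r : Role} {a : T} (h : m' r = some a)
    (h' : ∀ r', r' ≠ r → m' r' = m r') :
    (B.fill q m).place (blockCell q r) a = B.fill q m' := by
  refine ext_blockCell fun q' r' => ?_
  by_cases hc : blockCell q' r' = blockCell q r
  · rw [hc, cell_place_self, cell_fill, h]
  · rw [cell_place_of_ne _ hc]
    by_cases hq : q' = q
    · subst hq
      rw [cell_fill, cell_fill, h']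
      rintro rfl; exact hc rfl
    · rw [cell_fill_of_ne _ _ _ hq, cell_fill_of_ne _ _ _ hq]

theorem fill_none (h : ∀ r, B.cell (blockCell q r) = none) : B.fill q (fun _ => none) = B := by
  refine ext_blockCell fun q' r' => ?_
  by_cases hq : q' = q
  · subst hq; rw [cell_fill, h]
  · rw [cell_fill_of_ne _ _ _ hq]

theorem fill_blockReplace {T' : Type*} (R : T → Fin 5 → Fin 4 → T') (A : Assembly T) (t : T) :
    (A.blockReplace R).fill q (fun r => some (R t r.1 r.2)) = (A.place q t).blockReplace R := by
  refine ext_blockCell fun q' r' => ?_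
  rw [cell_blockReplace]
  by_cases hq : q' = q
  · subst hq; rw [cell_fill, cell_place_self]; rfl
  · rw [cell_fill_of_ne _ _ _ hq, cell_place_of_ne _ hq, cell_blockReplace]

end Assembly

theorem blockCell_add_vec (q : ℤ × ℤ) (r : Role) (d : Side) :
    blockCell q r + d.vec = match d with
      | .north => if h : r.2.val + 1 < 4 then blockCell q (r.1, ⟨r.2 + 1, h⟩)
          else blockCell (q + Side.north.vec) (r.1, 0)
      | .east => if h : r.1.val + 1 < 5 then blockCell q (⟨r.1 + 1, h⟩, r.2)
          else blockCell (q + Side.east.vec) (0, r.2)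
      | .south => if 0 < r.2.val then blockCell q (r.1, ⟨r.2 - 1, by omega⟩)
          else blockCell (q + Side.south.vec) (r.1, 3)
      | .west => if 0 < r.1.val then blockCell q (⟨r.1 - 1, by omega⟩, r.2)
          else blockCell (q + Side.west.vec) (4, r.2) := by
  obtain ⟨x, y⟩ := q
  obtain ⟨i, j⟩ := r
  have h3 : ((3 : Fin 4) : ℕ) = 3 := rfl
  have h4 : ((4 : Fin 5) : ℕ) = 4 := rfl
  cases d <;> dsimp only <;> split_ifs with h <;>
    simp only [blockCell, Side.vec, Prod.mk_add_mk, Prod.mk.injEq, Fin.val_zero, h3, h4] <;>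
    omega

/-- How far a block is filled: the number of tiles on the early path, whether the cells of `heads`
and `tails` and the contested cell are occupied, and the number of tiles on the late path. -/
structure Stage where
  early : ℕ
  hasHeads : Bool
  hasTails : Bool
  hasContested : Bool
  late : ℕ

namespace Stage

/-- The cells that are occupied at a stage. -/
def Filled (S : Stage) (r : Role) : Bool :=
  if r = heads then S.hasHeads
  else if r = tails then S.hasTails
  else if r = contested then S.hasContested
  else if r.IsLate then rank r < S.late
  else rank r < S.early

end Stage

/-- The content of the cell at side `d` of the cell `r` of a block with the contents `m`, if the
block to the west has the contents `w` in its last column, and the other adjacent blocks are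
empty. -/
def look {α : Type*} (m : Role → Option α) (w : Fin 4 → α) (r : Role) : Side → Option α
  | .north => if h : r.2.val + 1 < 4 then m (r.1, ⟨r.2 + 1, h⟩) else none
  | .east => if h : r.1.val + 1 < 5 then m (⟨r.1 + 1, h⟩, r.2) else none
  | .south => if 0 < r.2.val then m (r.1, ⟨r.2 - 1, by omega⟩) else none
  | .west => if 0 < r.1.val then m (⟨r.1 - 1, by omega⟩, r.2) else some (w r.2)

/-- The roles in a block at a given stage. -/
def Stage.roles (S : Stage) (z r : Role) : Option Role :=
  if S.Filled r then some (roleAt z r) else none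

/-- The strength of the bonds of a tile of role `s` at the cell `r`, as far as labels go. -/
def Stage.bound (S : Stage) (z r s : Role) : ℕ :=
  ([Side.north, Side.east, Side.south, Side.west].map fun d =>
    match look (S.roles z) (fun j => (4, j)) r d with
    | some a => if label s d = label a d.opp then labelStr (label s d) else 0
    | none => 0).sum

/-- All attachments to a block at the stage `S` that the labels allow are in the list `l`. -/
def Stage.Allows (S : Stage) (z : Role) (l : List (Role × Role)) : Bool :=
  decide (∀ r s, S.Filled r = false → 2 ≤ S.bound z r s → (r, s) ∈ l)

/-- The data that determine the glues of the simulating system: the representative of the set of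
all tile types with the same glue on the west side, and the representative of the set of all tile
types that can be attached to the east. -/
structure ChainData (K : Type*) where
  rep : K → K
  next : K → Option K

namespace ChainData

variable {K : Type*} (D : ChainData K)

/-- Besides `k`, another tile type is represented by `k`. -/
def Paired (k : K) : Prop := ∃ k', k' ≠ k ∧ D.rep k' = k

open Classical in
/-- The part of the glue, besides its label, on a side of a tile type: a number and a datum. The
number `1` to the south of `heads` keeps `tails` off the contested cell where no coin is to be
flipped, and the number `2` makes the first tile of the late path of a block whose coin falls for
`tails` join a `tails` at the contested cell, and no `heads`. -/
noncomputable def glueData (a : K × Role) (d : Side) : ℕ × Option K :=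
  if a.2 = heads ∧ d = .south then (if D.Paired a.1 then 0 else 1, some a.1)
  else if a.2 = tails ∧ d = .south then (2, some a.1)
  else if a.2 = (0, 0) ∧ d = .north then
    (if D.rep a.1 = a.1 then if D.Paired a.1 then 0 else 1 else 2, some (D.rep a.1))
  else if a.2 = (1, 0) ∧ d = .north then (2, some (D.rep a.1))
  else if a.2 = (0, 0) ∧ d = .west then (0, none)
  else if a.2 = (4, 0) ∧ d = .east then (0, none)
  else if a.2.1 = 4 ∧ d = .east then (0, D.next a.1)
  else (0, some a.1)

/-- The glues of the simulating system. -/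
noncomputable def glue (a : K × Role) (d : Side) : ℕ × ℕ × Option K :=
  (label a.2 d, D.glueData a d)

open Classical in
/-- The role of the tile at the contested cell of the block that stands for `k`. -/
noncomputable def winner (k : K) : Role := if D.rep k = k then heads else tails

theorem winner_eq (k : K) : D.winner k = heads ∨ D.winner k = tails := by
  unfold winner
  split_ifs <;> simp

/-- The block that stands for `k`. -/
noncomputable def block (k : K) (r : Role) : K × Role :=
  (if r.IsLate then k else D.rep k, roleAt (D.winner k) r)

end ChainData

/-- The strength of the glues of the simulating system. -/
def glueStr {K : Type*} (g : ℕ × ℕ × Option K) : ℕ := labelStr g.1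

/-! ### Attachments next to a row of complete blocks -/

open Assembly

/-- The occupied cells of `A` are those of the row of `q` from `x₀` up to the cell before `q`, with
the tile types `a` in the first and `s` in the last of them. -/
structure IsRow {T : Type*} (A : Assembly T) (x₀ : ℤ) (q : ℤ × ℤ) (a s : T) : Prop where
  cell_ne : ∀ p, A.cell p ≠ none ↔ p.2 = q.2 ∧ x₀ ≤ p.1 ∧ p.1 < q.1
  first : A.cell (x₀, q.2) = some a
  last : A.cell (q.1 - 1, q.2) = some s

theorem IsRow.cell_eq_none {T : Type*} {A : Assembly T} {x₀ : ℤ} {q p : ℤ × ℤ} {a s : T}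
    (hA : IsRow A x₀ q a s) (hp : ¬(p.2 = q.2 ∧ x₀ ≤ p.1 ∧ p.1 < q.1)) : A.cell p = none :=
  not_ne_iff.1 (mt (hA.cell_ne p).1 hp)

theorem IsRow.lt {T : Type*} {A : Assembly T} {x₀ : ℤ} {q : ℤ × ℤ} {a s : T}
    (hA : IsRow A x₀ q a s) : x₀ < q.1 :=
  ((hA.cell_ne (x₀, q.2)).1 (by simp [hA.first])).2.2

namespace ChainData

variable {T K : Type*} (D : ChainData K)

/-- The block mapping of the simulation, where `e` maps the tile types to the data. -/
noncomputable def blocks (e : T → K) (t : T) (i : Fin 5) (j : Fin 4) : K × Role :=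
  D.block (e t) (i, j)

/-- The total strength of the bonds of a tile of type `b` at the cell `r` of a block with the
contents `m`, to the east of the complete block that stands for `s`. -/
noncomputable def localWeight (m : Role → Option (K × Role)) (s : K) (r : Role)
    (b : K × Role) : ℕ :=
  ∑ d : Side, bondWith D.glue glueStr b d (look m (fun j => (s, (4, j))) r d)

/-- The tile system has the tile types and glues of the simulating system. -/
structure IsSimulator (Γs : TileSystem (K × Role) (ℕ × ℕ × Option K)) : Prop where
  glue_eq : Γs.glue = D.glue
  str_eq : Γs.str = glueStr
  temperature_eq : Γs.temperature = 2

variable {D}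

theorem bondWith_le_labelStr (b : K × Role) (d : Side) (c : K × Role) :
    bondWith D.glue glueStr b d (some c) ≤ labelStr (label c.2 d.opp) := by
  rw [bondWith_some]
  split_ifs with h
  · rw [h]; rfl
  · exact Nat.zero_le _

theorem bondWith_eq_zero_of_label {b : K × Role} {d : Side} {o : Option (K × Role)}
    (h : ∀ c, o = some c → label c.2 d.opp = 0) : bondWith D.glue glueStr b d o = 0 := by
  rcases o with _ | c
  · rfl
  · exact Nat.le_zero.1 ((bondWith_le_labelStr b d c).trans_eq (by rw [h c rfl]; rfl))

theorem bondWith_le_one_of_labelStr {b : K × Role} {d : Side} {o : Option (K × Role)}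
    (h : ∀ c, o = some c → labelStr (label c.2 d.opp) ≤ 1) :
    bondWith D.glue glueStr b d o ≤ 1 := by
  rcases o with _ | c
  · exact Nat.zero_le 1
  · exact (bondWith_le_labelStr b d c).trans (h c rfl)

theorem accepts_block (k : K) (r : Role) : Accepts r (D.block k r).2 :=
  accepts_roleAt (D.winner_eq k) r

variable {e : T → K} {A : Assembly T} {x₀ : ℤ} {q q' : ℤ × ℤ} {a s : T} {r : Role}
  {m : Role → Option (K × Role)}

theorem accepts_cell_fill (hm : ∀ r b, m r = some b → Accepts r b.2) {b : K × Role}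
    (h : ((A.blockReplace (D.blocks e)).fill q m).cell (blockCell q' r) = some b) :
    Accepts r b.2 := by
  by_cases hq : q' = q
  · subst hq
    rw [cell_fill] at h
    exact hm r b h
  · rw [cell_fill_of_ne _ _ _ hq, cell_blockReplace] at h
    obtain ⟨t, -, rfl⟩ := Option.map_eq_some_iff.1 h
    exact accepts_block _ _

theorem cell_neighbor (hA : IsRow A x₀ q a s) (m : Role → Option (K × Role)) (r : Role)
    (d : Side) :
    ((A.blockReplace (D.blocks e)).fill q m).cell (blockCell q r + d.vec) =
      look m (fun j => (e s, (4, j))) r d := by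
  have hwest : q + Side.west.vec = (q.1 - 1, q.2) := by
    ext <;> simp [Side.vec, sub_eq_add_neg]
  rw [blockCell_add_vec]
  cases d <;> dsimp only [look] <;> split_ifs
  all_goals
    first
    | rw [cell_fill]
    | rw [cell_fill_of_ne _ _ _ (by simp [Side.vec]), cell_blockReplace, hwest, hA.last]
      simp [blocks, block, IsLate, roleAt]
    | rw [cell_fill_of_ne _ _ _ (by simp [Side.vec]), cell_blockReplace,
        hA.cell_eq_none (by simp [Side.vec]), Option.map_none]

theorem attachWeight_eq_localWeight (hA : IsRow A x₀ q a s) (m : Role → Option (K × Role))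
    (r : Role) (b : K × Role) :
    ((A.blockReplace (D.blocks e)).fill q m).attachWeight D.glue glueStr (blockCell q r) b =
      D.localWeight m (e s) r b := by
  simp only [attachWeight, localWeight, cell_neighbor hA]

theorem cell_fill_eq_none (hq : q' ≠ q) (hq' : A.cell q' = none) (r : Role) :
    ((A.blockReplace (D.blocks e)).fill q m).cell (blockCell q' r) = none := by
  rw [cell_fill_of_ne _ _ _ hq, cell_blockReplace, hq', Option.map_none]

variable (b : K × Role)

theorem bondWith_north_fill (hm : ∀ r b, m r = some b → Accepts r b.2) (hq : q' ≠ q)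
    (hq' : A.cell q' = none) :
    bondWith D.glue glueStr b .north (((A.blockReplace (D.blocks e)).fill q m).cell
      (blockCell q' r + Side.north.vec)) = 0 := by
  rw [blockCell_add_vec]
  dsimp only
  split_ifs
  · rw [cell_fill_eq_none hq hq', bondWith_none]
  · exact bondWith_eq_zero_of_label fun c hc =>
      label_south_eq_zero (accepts_cell_fill hm hc) rfl

theorem bondWith_south_fill (hm : ∀ r b, m r = some b → Accepts r b.2) (hq : q' ≠ q)
    (hq' : A.cell q' = none) :
    bondWith D.glue glueStr b .south (((A.blockReplace (D.blocks e)).fill q m).cell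
      (blockCell q' r + Side.south.vec)) = 0 := by
  rw [blockCell_add_vec]
  dsimp only
  split_ifs
  · rw [cell_fill_eq_none hq hq', bondWith_none]
  · exact bondWith_eq_zero_of_label fun c hc =>
      label_north_eq_zero (accepts_cell_fill hm hc) rfl

theorem bondWith_east_fill_of_lt (hr : r.1.val + 1 < 5) (hq : q' ≠ q) (hq' : A.cell q' = none) :
    bondWith D.glue glueStr b .east (((A.blockReplace (D.blocks e)).fill q m).cell
      (blockCell q' r + Side.east.vec)) = 0 := by
  rw [blockCell_add_vec]
  dsimp only
  rw [dif_pos hr, cell_fill_eq_none hq hq', bondWith_none]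

theorem bondWith_west_fill_of_pos (hr : 0 < r.1.val) (hq : q' ≠ q) (hq' : A.cell q' = none) :
    bondWith D.glue glueStr b .west (((A.blockReplace (D.blocks e)).fill q m).cell
      (blockCell q' r + Side.west.vec)) = 0 := by
  rw [blockCell_add_vec]
  dsimp only
  rw [if_pos hr, cell_fill_eq_none hq hq', bondWith_none]

theorem bondWith_entry_eq_zero (hfirst : ∀ k, D.next k ≠ some (D.rep (e a))) :
    bondWith D.glue glueStr b .east (some (D.blocks e a 0 3)) = 0 := by
  rw [bondWith_some, if_neg]
  intro hg
  obtain ⟨k, s⟩ := b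
  obtain rfl : s = (4, 3) := eq_exit_of_label_east (congrArg Prod.fst hg)
  have hdata := congrArg (Prod.snd ∘ Prod.snd) hg
  refine hfirst k ?_
  simpa [glue, glueData, blocks, block, roleAt, IsLate, Side.opp] using hdata

theorem bondWith_east_fill_le_one (hA : IsRow A x₀ q a s)
    (hfirst : ∀ k, D.next k ≠ some (D.rep (e a))) (hm : ∀ r b, m r = some b → Accepts r b.2)
    (hr : ¬r.1.val + 1 < 5) (hq' : A.cell q' = none) :
    bondWith D.glue glueStr b .east (((A.blockReplace (D.blocks e)).fill q m).cell
      (blockCell q' r + Side.east.vec)) ≤ 1 := by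
  rw [blockCell_add_vec]
  dsimp only
  rw [dif_neg hr]
  by_cases htop : r.2 = 3
  · have hne : q' + Side.east.vec ≠ q := by
      rintro rfl
      have hlast := hA.last
      simp [Side.vec, hq'] at hlast
    rw [cell_fill_of_ne _ _ _ hne, cell_blockReplace, htop]
    rcases hc : A.cell (q' + Side.east.vec) with _ | c
    · exact Nat.zero_le 1
    have hrow := (hA.cell_ne _).1 (by rw [hc]; simp : A.cell (q' + Side.east.vec) ≠ none)
    have hempty := mt (hA.cell_ne q').2 (not_not.2 hq')
    have hx : q' + Side.east.vec = (x₀, q.2) := by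
      simp only [Side.vec, Prod.fst_add, Prod.snd_add] at hrow
      ext <;> simp [Side.vec] <;> omega
    obtain rfl : a = c := Option.some.inj (by rw [← hA.first, ← hx, hc])
    exact (bondWith_entry_eq_zero b hfirst).trans_le zero_le_one
  · exact bondWith_le_one_of_labelStr fun c hc =>
      labelStr_west_le_one (accepts_cell_fill hm hc) rfl htop

theorem bondWith_west_fill_le_one (hA : IsRow A x₀ q a s)
    (hm : ∀ r b, m r = some b → Accepts r b.2) (hexit : m (4, 3) = none) (hr : ¬0 < r.1.val)
    (hq : q' ≠ q) (hq' : A.cell q' = none) :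
    bondWith D.glue glueStr b .west (((A.blockReplace (D.blocks e)).fill q m).cell
      (blockCell q' r + Side.west.vec)) ≤ 1 := by
  rw [blockCell_add_vec]
  dsimp only
  rw [if_neg hr]
  by_cases htop : r.2 = 3
  · suffices hnone : ((A.blockReplace (D.blocks e)).fill q m).cell
        (blockCell (q' + Side.west.vec) (4, r.2)) = none by
      rw [hnone]; exact Nat.zero_le 1
    by_cases hqq : q' + Side.west.vec = q
    · rw [hqq, cell_fill, htop, hexit]
    · refine cell_fill_eq_none hqq (hA.cell_eq_none ?_) _
      have hempty := mt (hA.cell_ne q').2 (not_not.2 hq')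
      simp only [Side.vec, Prod.fst_add, Prod.snd_add, Prod.ext_iff, ne_eq] at hq ⊢
      omega
  · exact bondWith_le_one_of_labelStr fun c hc =>
      labelStr_east_le_one (accepts_cell_fill hm hc) rfl htop

/-- An empty block is five cells wide, so a tile in it cannot bind both to the block to its west
and to the block to its east. -/
theorem attachWeight_fill_lt_two (hA : IsRow A x₀ q a s)
    (hfirst : ∀ k, D.next k ≠ some (D.rep (e a))) (hm : ∀ r b, m r = some b → Accepts r b.2)
    (hexit : m (4, 3) = none) (hq : q' ≠ q) (hq' : A.cell q' = none) :
    ((A.blockReplace (D.blocks e)).fill q m).attachWeight D.glue glueStr (blockCell q' r) b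
      < 2 := by
  rw [attachWeight, Side.sum_eq, bondWith_north_fill b hm hq hq', bondWith_south_fill b hm hq hq']
  by_cases hr : r.1.val + 1 < 5
  · rw [bondWith_east_fill_of_lt b hr hq hq']
    by_cases hr' : 0 < r.1.val
    · rw [bondWith_west_fill_of_pos b hr' hq hq']
      exact two_pos
    · have hwest := bondWith_west_fill_le_one (D := D) (e := e) b hA hm hexit hr' hq hq'
      omega
  · rw [bondWith_west_fill_of_pos b (by omega) hq hq']
    have heast := bondWith_east_fill_le_one (D := D) b hA hfirst hm hr hq'
    omega

variable {b}

theorem mem_frontier_fill_iff {Γs : TileSystem (K × Role) (ℕ × ℕ × Option K)}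
    (hΓ : D.IsSimulator Γs) (hA : IsRow A x₀ q a s)
    (hfirst : ∀ k, D.next k ≠ some (D.rep (e a))) (hm : ∀ r b, m r = some b → Accepts r b.2)
    (hexit : m (4, 3) = none)
    (hprod : Γs.Producible ((A.blockReplace (D.blocks e)).fill q m)) {p : ℤ × ℤ} :
    (p, b) ∈ Γs.frontier ((A.blockReplace (D.blocks e)).fill q m) ↔
      ∃ r, p = blockCell q r ∧ m r = none ∧ 2 ≤ D.localWeight m (e s) r b := by
  rw [hprod.mem_frontier_iff, hΓ.glue_eq, hΓ.str_eq, hΓ.temperature_eq]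
  constructor
  · rintro ⟨hp, hb⟩
    rw [← blockCell_blockOf_roleOf p] at hp hb
    by_cases hq : blockOf p = q
    · rw [hq] at hp hb
      rw [cell_fill] at hp
      rw [attachWeight_eq_localWeight hA] at hb
      exact ⟨roleOf p, by rw [← hq, blockCell_blockOf_roleOf], hp, hb⟩
    · rw [cell_fill_of_ne _ _ _ hq, cell_blockReplace, Option.map_eq_none_iff] at hp
      exact absurd hb (attachWeight_fill_lt_two b hA hfirst hm hexit hq hp).not_ge
  · rintro ⟨r, rfl, hr, hb⟩
    rw [cell_fill, attachWeight_eq_localWeight hA]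
    exact ⟨hr, hb⟩

end ChainData

theorem look_map {α β : Type*} (f : α → β) (m : Role → Option α) (w : Fin 4 → α) (r : Role)
    (d : Side) : look (fun r => (m r).map f) (fun j => f (w j)) r d = (look m w r d).map f := by
  cases d <;> simp only [look] <;> split_ifs <;> rfl

/-- The contents of a block that stands for `t` at the stage `S`, where `ρ` is the representative
of `t`, and `z` the role of the tile at the contested cell. -/
def Stage.contents {K : Type*} (S : Stage) (ρ t : K) (z r : Role) : Option (K × Role) :=
  if S.Filled r then some (if r.IsLate then t else ρ, roleAt z r) else none

theorem Stage.contents_map {K : Type*} (S : Stage) (ρ t : K) (z r : Role) :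
    (S.contents ρ t z r).map Prod.snd = S.roles z r := by
  unfold contents roles
  split_ifs <;> rfl

namespace ChainData

variable {K : Type*} {D : ChainData K}

theorem localWeight_le_bound (S : Stage) (ρ t s : K) (z r : Role) (b : K × Role) :
    D.localWeight (S.contents ρ t z) s r b ≤ S.bound z r b.2 := by
  have hside (d : Side) : bondWith D.glue glueStr b d
      (look (S.contents ρ t z) (fun j => (s, (4, j))) r d) ≤
      match look (S.roles z) (fun j => (4, j)) r d with
      | some a => if label b.2 d = label a d.opp then labelStr (label b.2 d) else 0
      | none => 0 := by
    have hroles := look_map Prod.snd (S.contents ρ t z) (fun j => (s, ((4 : Fin 5), j))) r d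
    simp only [Stage.contents_map] at hroles
    rw [show S.roles z = fun r => S.roles z r from rfl, hroles]
    rcases look (S.contents ρ t z) (fun j => (s, (4, j))) r d with _ | a
    · exact Nat.zero_le _
    · simp only [Option.map_some, bondWith_some]
      split_ifs with hglue hlabel
      · exact le_rfl
      · exact absurd (congrArg Prod.fst hglue) hlabel
      · exact Nat.zero_le _
      · exact le_rfl
  rw [localWeight, Side.sum_eq]
  simp only [Stage.bound, List.map_cons, List.map_nil, List.sum_cons, List.sum_nil, add_zero]
  exact add_le_add (hside _) (add_le_add (hside _) (add_le_add (hside _) (hside _)))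

theorem mem_of_allows {S : Stage} {z : Role} {l : List (Role × Role)} (h : S.Allows z l)
    {ρ t s : K} {r : Role} {b : K × Role} (hr : S.contents ρ t z r = none)
    (hw : 2 ≤ D.localWeight (S.contents ρ t z) s r b) : (r, b.2) ∈ l := by
  refine (of_decide_eq_true h) r b.2 ?_ (hw.trans (localWeight_le_bound S ρ t s z r b))
  unfold Stage.contents at hr
  simpa using hr

open Classical in
theorem bondWith_glue (b a : K × Role) (d : Side) :
    bondWith D.glue glueStr b d (some a) =
      if label b.2 d = label a.2 d.opp then
        if D.glueData b d = D.glueData a d.opp then labelStr (label b.2 d) else 0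
      else 0 := by
  rw [bondWith_some]
  by_cases hlabel : label b.2 d = label a.2 d.opp <;>
    by_cases hdata : D.glueData b d = D.glueData a d.opp <;>
      simp [glue, hlabel, hdata, glueStr]

variable (D) in
/-- The possible attachments to a block at the stage `S`, to the east of the complete block that
stands for `s`. -/
def localFrontier (S : Stage) (ρ t s : K) (z : Role) : Set (Role × (K × Role)) :=
  {x | S.contents ρ t z x.1 = none ∧ 2 ≤ D.localWeight (S.contents ρ t z) s x.1 x.2}

theorem localFrontier_eq {S : Stage} {z : Role} {l : List (Role × Role)} (h : S.Allows z l)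
    (hl : ∀ x ∈ l, S.Filled x.1 = false) {ρ t s : K} {F : Set (Role × (K × Role))}
    (hF : ∀ x ∈ F, (x.1, x.2.2) ∈ l)
    (hw : ∀ x ∈ l, ∀ k, 2 ≤ D.localWeight (S.contents ρ t z) s x.1 (k, x.2) ↔
      (x.1, (k, x.2)) ∈ F) :
    D.localFrontier S ρ t s z = F := by
  ext ⟨r, k, s'⟩
  constructor
  · rintro ⟨hnone, hweight⟩
    exact (hw _ (mem_of_allows h hnone hweight) k).1 hweight
  · intro hx
    refine ⟨?_, (hw _ (hF _ hx) k).2 hx⟩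
    simp only [Stage.contents, hl _ (hF _ hx), Bool.false_eq_true, if_false]

end ChainData

/-- The cells of the path before the coin flip. -/
def Role.earlyCell (n : ℕ) : Role :=
  ([(0, 3), (1, 3), (2, 3), (3, 3), (3, 2), (3, 1), (2, 1), (2, 2), (1, 2)] : List Role).getD n
    (0, 0)

/-- The cells of the path after the coin flip. -/
def Role.lateCell (n : ℕ) : Role :=
  ([(0, 0), (1, 0), (2, 0), (3, 0), (4, 0), (4, 1), (4, 2), (4, 3)] : List Role).getD n (0, 0)

namespace Stage

/-- The stages before the coin flip. -/
abbrev start (n : ℕ) : Stage := ⟨n, false, false, false, 0⟩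

/-- The stages after the coin flip. -/
abbrev final (n : ℕ) : Stage := ⟨9, true, true, true, n⟩

/-- After the path before the coin flip, a tile has been attached at the cell of `heads`. -/
abbrev headsFirst : Stage := ⟨9, true, false, false, 0⟩

/-- After the path before the coin flip, a tile has been attached at the cell of `tails`. -/
abbrev tailsFirst : Stage := ⟨9, false, true, false, 0⟩

/-- The tiles around the contested cell have been attached, and `heads` and `tails` compete for
it. -/
abbrev undecided : Stage := ⟨9, true, true, false, 0⟩

/-- The contested cell has been filled, by `heads`, while the cell of `heads` is still empty. -/
abbrev headsEarly : Stage := ⟨9, false, true, true, 0⟩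

/-- The contested cell has been filled, by `tails`, while the cell of `tails` is still empty. -/
abbrev tailsEarly : Stage := ⟨9, true, false, true, 0⟩

theorem allows_start : ∀ n < 9, (start n).Allows heads [(earlyCell n, earlyCell n)] = true := by
  decide +kernel

theorem allows_final_heads : ∀ n < 8, (final n).Allows heads [(lateCell n, lateCell n)] = true := by
  decide +kernel

theorem allows_final_tails : ∀ n < 8, (final n).Allows tails [(lateCell n, lateCell n)] = true := by
  decide +kernel

theorem filled_earlyCell : ∀ n < 9, (start n).Filled (earlyCell n) = false := by decide +kernel

theorem filled_lateCell : ∀ n < 8, (final n).Filled (lateCell n) = false := by decide +kernel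

end Stage

namespace ChainData

variable {K : Type*} {D : ChainData K} {ρ t s : K}

open Stage

attribute [local simp] localWeight Side.sum_eq look contents Filled bondWith_glue bondWith_none
  glueData label labelTable sideIndex rank IsLate roleAt Side.opp labelStr earlyCell lateCell

theorem localFrontier_start (hs : D.next s = some ρ) {n : ℕ} (hn : n < 9) :
    D.localFrontier (start n) ρ t s heads = {(earlyCell n, (ρ, earlyCell n))} := by
  refine localFrontier_eq (allows_start n hn) (by simpa using filled_earlyCell n hn)
    (by simp) ?_
  interval_cases n <;> simp [hs] <;> grind

theorem localFrontier_start_of_none (hs : D.next s = none) :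
    D.localFrontier (start 0) ρ t s heads = ∅ :=
  localFrontier_eq (l := [((0, 3), (0, 3))]) (by decide +kernel) (by decide +kernel) (by simp)
    (by simp [hs])

theorem localFrontier_trigger :
    D.localFrontier (start 9) ρ t s heads = {(heads, (ρ, heads)), (tails, (ρ, tails))} := by
  refine localFrontier_eq (l := [(heads, heads), (tails, tails)]) (by decide +kernel)
    (by decide +kernel) (by simp) ?_
  simp; grind

theorem localFrontier_headsFirst (hs : D.next s = some ρ) :
    D.localFrontier headsFirst ρ t s heads =
      {x | x = (tails, (ρ, tails)) ∨ x = (contested, (ρ, tails)) ∧ D.Paired ρ} := by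
  refine localFrontier_eq (l := [(tails, tails), (contested, tails)]) (by decide +kernel)
    (by decide +kernel) (by rintro x (rfl | ⟨rfl, -⟩) <;> simp) ?_
  simp [hs]; grind

theorem localFrontier_tailsFirst (hs : D.next s = some ρ) :
    D.localFrontier tailsFirst ρ t s heads =
      {(contested, (ρ, heads)), (heads, (ρ, heads))} := by
  refine localFrontier_eq (l := [(contested, heads), (heads, heads)]) (by decide +kernel)
    (by decide +kernel) (by simp) ?_
  simp [hs]; grind

theorem localFrontier_undecided (hs : D.next s = some ρ) :
    D.localFrontier undecided ρ t s heads =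
      {x | x = (contested, (ρ, heads)) ∨ x = (contested, (ρ, tails)) ∧ D.Paired ρ} := by
  refine localFrontier_eq (l := [(contested, heads), (contested, tails)]) (by decide +kernel)
    (by decide +kernel) (by rintro x (rfl | ⟨rfl, -⟩) <;> simp) ?_
  simp [hs]; grind

theorem localFrontier_headsEarly (hρ : D.rep ρ = ρ) :
    D.localFrontier headsEarly ρ t s heads =
      {(heads, (ρ, heads)), ((0, 0), (ρ, (0, 0)))} := by
  refine localFrontier_eq (l := [(heads, heads), ((0, 0), (0, 0))]) (by decide +kernel)
    (by decide +kernel) (by simp) ?_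
  simp; grind

theorem localFrontier_tailsEarly (ht : D.rep t = ρ) (hne : t ≠ ρ)
    (huniq : ∀ k, D.rep k = ρ → k = ρ ∨ k = t) :
    D.localFrontier tailsEarly ρ t s tails =
      {(tails, (ρ, tails)), ((0, 0), (t, (0, 0)))} := by
  refine localFrontier_eq (l := [(tails, tails), ((0, 0), (0, 0))]) (by decide +kernel)
    (by decide +kernel) (by simp) ?_
  simp; grind

theorem localFrontier_tailsEarly_late :
    D.localFrontier ⟨9, true, false, true, 1⟩ ρ t s tails = {(tails, (ρ, tails))} := by
  refine localFrontier_eq (l := [(tails, tails)]) (by decide +kernel)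
    (by decide +kernel) (by simp) ?_
  simp; grind

theorem localFrontier_final_heads (hρ : D.rep ρ = ρ) {n : ℕ} (hn : n < 8) :
    D.localFrontier (final n) ρ ρ s heads = {(lateCell n, (ρ, lateCell n))} := by
  refine localFrontier_eq (allows_final_heads n hn) (by simpa using filled_lateCell n hn)
    (by simp) ?_
  interval_cases n <;> simp <;> grind

theorem localFrontier_final_tails (ht : D.rep t = ρ) (hne : t ≠ ρ)
    (huniq : ∀ k, D.rep k = ρ → k = ρ ∨ k = t) {n : ℕ} (hn : n < 8) :
    D.localFrontier (final n) ρ t s tails = {(lateCell n, (t, lateCell n))} := by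
  refine localFrontier_eq (allows_final_tails n hn) (by simpa using filled_lateCell n hn)
    (by simp) ?_
  interval_cases n <;> simp <;> grind

end ChainData

/-! ### The growth of a block -/

namespace Stage

theorem contents_of_late_eq_zero {K : Type*} {S : Stage} (hS : S.late = 0) (ρ t t' : K)
    (z : Role) : S.contents ρ t z = S.contents ρ t' z := by
  funext r
  have hlate (hr : r.IsLate = true) : S.Filled r = false := by
    have hne : r ≠ heads ∧ r ≠ tails ∧ r ≠ contested := by
      refine ⟨?_, ?_, ?_⟩ <;> rintro rfl <;> exact absurd hr (by decide)
    simp [Filled, hne, hr, hS]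
  unfold contents
  by_cases hr : r.IsLate = true
  · simp [hlate hr]
  · simp [hr]

theorem contents_start_zero {K : Type*} (ρ t : K) (z : Role) :
    (start 0).contents ρ t z = fun _ => none := by
  funext r
  have hempty : (start 0).Filled r = false := by revert r; decide +kernel
  simp [contents, hempty]

theorem filled_start_succ : ∀ n < 9, (start (n + 1)).Filled (earlyCell n) = true ∧
    ∀ r, r ≠ earlyCell n → (start (n + 1)).Filled r = (start n).Filled r := by decide +kernel

theorem filled_final_succ : ∀ n < 8, (final (n + 1)).Filled (lateCell n) = true ∧
    ∀ r, r ≠ lateCell n → (final (n + 1)).Filled r = (final n).Filled r := by decide +kernel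

theorem filled_start_exit : ∀ n < 9, (start n).Filled (4, 3) = false := by decide +kernel

theorem filled_final_exit : ∀ n < 8, (final n).Filled (4, 3) = false := by decide +kernel

theorem isLate_earlyCell : ∀ n < 9, (earlyCell n).IsLate = false ∧ earlyCell n ≠ contested := by
  decide +kernel

theorem isLate_lateCell : ∀ n < 8, (lateCell n).IsLate = true ∧ lateCell n ≠ contested := by
  decide +kernel

theorem filled_final : ∀ r, (final 8).Filled r = true := by decide +kernel

end Stage

namespace ChainData

open Stage

variable {T K : Type*}

/-- The row `A` ends with a tile of type `s` to the west of `q`, and no tile of the simulating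
system can be attached at its other end. -/
structure IsGrowing (D : ChainData K) (Γs : TileSystem (K × Role) (ℕ × ℕ × Option K)) (e : T → K)
    (A : Assembly T) (q : ℤ × ℤ) (s : T) : Prop where
  sim : D.IsSimulator Γs
  row : ∃ x₀ a, IsRow A x₀ q a s ∧ ∀ k, D.next k ≠ some (D.rep (e a))

/-- The assembly that stands for `A`, with an incomplete block at `q`. -/
noncomputable def partialBlock (D : ChainData K) (e : T → K) (A : Assembly T) (q : ℤ × ℤ)
    (S : Stage) (ρ t : K) (z : Role) : Assembly (K × Role) :=
  (A.blockReplace (D.blocks e)).fill q (S.contents ρ t z)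

variable {D : ChainData K} {Γs : TileSystem (K × Role) (ℕ × ℕ × Option K)} {e : T → K}
  {A : Assembly T} {q : ℤ × ℤ} {s : T} {S S' : Stage} {ρ t : K} {z z' r : Role} {b : K × Role}

theorem partialBlock_start_zero (h : D.IsGrowing Γs e A q s) :
    D.partialBlock e A q (start 0) ρ t z = A.blockReplace (D.blocks e) := by
  obtain ⟨x₀, a, hA, -⟩ := h.row
  rw [partialBlock, contents_start_zero, fill_none]
  intro r
  rw [cell_blockReplace, hA.cell_eq_none (by simp), Option.map_none]

theorem partialBlock_final (u : T) :
    D.partialBlock e A q (final 8) (D.rep (e u)) (e u) (D.winner (e u)) =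
      (A.place q u).blockReplace (D.blocks e) := by
  rw [← fill_blockReplace, partialBlock]
  congr 1
  funext r
  simp [contents, filled_final, blocks, block]

theorem partialBlock_congr {t' : K} (hS : S.late = 0) :
    D.partialBlock e A q S ρ t z = D.partialBlock e A q S ρ t' z := by
  rw [partialBlock, partialBlock, contents_of_late_eq_zero hS ρ t t']

theorem accepts_contents (hz : z = heads ∨ z = tails) (r : Role) (b : K × Role)
    (hb : S.contents ρ t z r = some b) : Accepts r b.2 := by
  have hrole : S.roles z r = some b.2 := by rw [← contents_map S ρ t z r, hb, Option.map_some]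
  unfold roles at hrole
  split_ifs at hrole
  exact Option.some.inj hrole ▸ accepts_roleAt hz r

theorem frontier_partialBlock (h : D.IsGrowing Γs e A q s) (hz : z = heads ∨ z = tails)
    (hexit : S.Filled (4, 3) = false) (hp : Γs.Producible (D.partialBlock e A q S ρ t z)) :
    Γs.frontier (D.partialBlock e A q S ρ t z) =
      (fun x => (blockCell q x.1, x.2)) '' D.localFrontier S ρ t (e s) z := by
  obtain ⟨x₀, a, hA, hfirst⟩ := h.row
  ext ⟨p, b⟩
  rw [partialBlock, mem_frontier_fill_iff h.sim hA hfirst (accepts_contents hz)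
    (by simp [contents, hexit]) hp]
  constructor
  · rintro ⟨r, rfl, hr, hb⟩
    exact ⟨(r, b), ⟨hr, hb⟩, rfl⟩
  · rintro ⟨⟨r, b'⟩, ⟨hr, hb⟩, heq⟩
    obtain ⟨rfl, rfl⟩ := Prod.mk.inj heq
    exact ⟨r, rfl, hr, hb⟩

theorem place_partialBlock (hr : S'.Filled r = true)
    (hS : ∀ r', r' ≠ r → S'.Filled r' = S.Filled r') (hz : z = z' ∨ r = contested) :
    (D.partialBlock e A q S ρ t z).place (blockCell q r)
        (if r.IsLate then t else ρ, roleAt z' r) =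
      D.partialBlock e A q S' ρ t z' := by
  refine fill_place _ _ (by simp [contents, hr]) fun r' hr' => ?_
  unfold contents
  rw [hS r' hr']
  rcases hz with rfl | rfl
  · rfl
  · simp [roleAt, hr']

theorem place_start {n : ℕ} (hn : n < 9) :
    (D.partialBlock e A q (start n) ρ t z).place (blockCell q (earlyCell n)) (ρ, earlyCell n) =
      D.partialBlock e A q (start (n + 1)) ρ t z := by
  obtain ⟨hearly, hne⟩ := isLate_earlyCell n hn
  obtain ⟨hfilled, hrest⟩ := filled_start_succ n hn
  simpa [roleAt, hearly, hne] using
    place_partialBlock (D := D) (e := e) (A := A) (q := q) (ρ := ρ) (t := t) hfilled hrest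
      (Or.inl (Eq.refl z))

theorem place_final {n : ℕ} (hn : n < 8) :
    (D.partialBlock e A q (final n) ρ t z).place (blockCell q (lateCell n)) (t, lateCell n) =
      D.partialBlock e A q (final (n + 1)) ρ t z := by
  obtain ⟨hlate, hne⟩ := isLate_lateCell n hn
  obtain ⟨hfilled, hrest⟩ := filled_final_succ n hn
  simpa [roleAt, hlate, hne] using
    place_partialBlock (D := D) (e := e) (A := A) (q := q) (ρ := ρ) (t := t) hfilled hrest
      (Or.inl (Eq.refl z))

theorem producible_place (h : D.IsGrowing Γs e A q s) (hz : z = heads ∨ z = tails)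
    (hexit : S.Filled (4, 3) = false) (hp : Γs.Producible (D.partialBlock e A q S ρ t z))
    (hb : (r, b) ∈ D.localFrontier S ρ t (e s) z) :
    Γs.Producible ((D.partialBlock e A q S ρ t z).place (blockCell q r) b) := by
  refine hp.attach ?_
  rw [frontier_partialBlock h hz hexit hp]
  exact ⟨(r, b), hb, rfl⟩

theorem producible_start (h : D.IsGrowing Γs e A q s) (hs : D.next (e s) = some ρ)
    (hp : Γs.Producible (D.partialBlock e A q (start 0) ρ t heads)) {n : ℕ} (hn : n ≤ 9) :
    Γs.Producible (D.partialBlock e A q (start n) ρ t heads) := by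
  induction n with
  | zero => exact hp
  | succ n ih =>
    rw [← place_start hn]
    exact producible_place h (Or.inl rfl) (filled_start_exit n hn) (ih (Nat.le_of_succ_le hn))
      (by rw [localFrontier_start hs hn]; rfl)

theorem producible_final (h : D.IsGrowing Γs e A q s) (hz : z = heads ∨ z = tails)
    (hF : ∀ n < 8, D.localFrontier (final n) ρ t (e s) z = {(lateCell n, (t, lateCell n))})
    (hp : Γs.Producible (D.partialBlock e A q (final 0) ρ t z)) {n : ℕ} (hn : n ≤ 8) :
    Γs.Producible (D.partialBlock e A q (final n) ρ t z) := by
  induction n with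
  | zero => exact hp
  | succ n ih =>
    rw [← place_final hn]
    exact producible_place h hz (filled_final_exit n hn) (ih (Nat.le_of_succ_le hn))
      (by rw [hF n hn]; rfl)

section Probability

variable [Fintype K] {C : Concentration (K × Role)} {X : Assembly (K × Role)}

theorem hit_of_const (h : D.IsGrowing Γs e A q s) (hX : Γs.frontier X = ∅)
    (hz : z = heads ∨ z = tails) (hexit : S.Filled (4, 3) = false)
    (hp : Γs.Producible (D.partialBlock e A q S ρ t z))
    (hne : (D.localFrontier S ρ t (e s) z).Nonempty) {v : ℝ≥0∞}
    (hv : ∀ x ∈ D.localFrontier S ρ t (e s) z,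
      Γs.hit C X ((D.partialBlock e A q S ρ t z).place (blockCell q x.1) x.2) = v) :
    Γs.hit C X (D.partialBlock e A q S ρ t z) = v := by
  have hF := frontier_partialBlock h hz hexit hp
  have hFne : (Γs.frontier (D.partialBlock e A q S ρ t z)).Nonempty := hF ▸ hne.image _
  rw [TileSystem.hit_eq_step hX hFne]
  refine TileSystem.step_const hp hFne fun p b hb => ?_
  rw [hF] at hb
  obtain ⟨x, hx, heq⟩ := hb
  obtain ⟨rfl, rfl⟩ := Prod.mk.inj heq
  exact hv x hx

theorem hit_forced (h : D.IsGrowing Γs e A q s) (hX : Γs.frontier X = ∅)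
    (hz : z = heads ∨ z = tails) (hexit : S.Filled (4, 3) = false)
    (hp : Γs.Producible (D.partialBlock e A q S ρ t z))
    (hF : D.localFrontier S ρ t (e s) z = {(r, b)}) :
    Γs.hit C X (D.partialBlock e A q S ρ t z) =
      Γs.hit C X ((D.partialBlock e A q S ρ t z).place (blockCell q r) b) :=
  hit_of_const h hX hz hexit hp (hF ▸ Set.singleton_nonempty _) (by simp [hF])

theorem hit_of_pair (h : D.IsGrowing Γs e A q s) (hX : Γs.frontier X = ∅)
    (hz : z = heads ∨ z = tails) (hexit : S.Filled (4, 3) = false)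
    (hp : Γs.Producible (D.partialBlock e A q S ρ t z))
    {r₁ r₂ : Role} {b₁ b₂ : K × Role} (hne : (r₁, b₁) ≠ (r₂, b₂))
    (hF : D.localFrontier S ρ t (e s) z = {(r₁, b₁), (r₂, b₂)}) :
    Γs.hit C X (D.partialBlock e A q S ρ t z) =
      C.conc b₁ / (C.conc b₁ + C.conc b₂) *
        Γs.hit C X ((D.partialBlock e A q S ρ t z).place (blockCell q r₁) b₁) +
      C.conc b₂ / (C.conc b₁ + C.conc b₂) *
        Γs.hit C X ((D.partialBlock e A q S ρ t z).place (blockCell q r₂) b₂) := by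
  have hF' := frontier_partialBlock h hz hexit hp
  rw [hF, Set.image_pair] at hF'
  rw [TileSystem.hit_eq_step hX (hF' ▸ Set.insert_nonempty _ _), TileSystem.step_pair _ hF']
  simpa [blockCell_inj] using hne

theorem hit_start (h : D.IsGrowing Γs e A q s) (hX : Γs.frontier X = ∅)
    (hs : D.next (e s) = some ρ) (hp : Γs.Producible (D.partialBlock e A q (start 0) ρ t heads))
    {n : ℕ} (hn : n ≤ 9) :
    Γs.hit C X (D.partialBlock e A q (start 0) ρ t heads) =
      Γs.hit C X (D.partialBlock e A q (start n) ρ t heads) := by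
  induction n with
  | zero => rfl
  | succ n ih =>
    have hn' := Nat.le_of_succ_le hn
    rw [ih hn', hit_forced h hX (Or.inl rfl) (filled_start_exit n hn)
      (producible_start h hs hp hn') (localFrontier_start hs hn), place_start hn]

theorem hit_final (h : D.IsGrowing Γs e A q s) (hX : Γs.frontier X = ∅)
    (hz : z = heads ∨ z = tails)
    (hF : ∀ n < 8, D.localFrontier (final n) ρ t (e s) z = {(lateCell n, (t, lateCell n))})
    (hp : Γs.Producible (D.partialBlock e A q (final 0) ρ t z)) {n : ℕ} (hn : n ≤ 8) :
    Γs.hit C X (D.partialBlock e A q (final 0) ρ t z) =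
      Γs.hit C X (D.partialBlock e A q (final n) ρ t z) := by
  induction n with
  | zero => rfl
  | succ n ih =>
    have hn' := Nat.le_of_succ_le hn
    rw [ih hn', hit_forced h hX hz (filled_final_exit n hn) (producible_final h hz hF hp hn')
      (hF n hn), place_final hn]

end Probability

end ChainData

/-! ### The outcome of the coin toss -/

theorem div_add_div_eq_one {a b : ℝ≥0} (ha : 0 < a) :
    (a : ℝ≥0∞) / (a + b) + b / (a + b) = 1 := by
  rw [← ENNReal.add_div, ENNReal.div_self]
  · simp [ha.ne']
  · exact ENNReal.add_ne_top.2 ⟨ENNReal.coe_ne_top, ENNReal.coe_ne_top⟩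

theorem div_add_self_eq {a : ℝ≥0} (ha : 0 < a) : (a : ℝ≥0∞) / (a + a) = 2⁻¹ := by
  have hne : (a : ℝ≥0∞) ≠ 0 := by simpa using ha.ne'
  rw [← two_mul, ← ENNReal.inv_div (Or.inl ENNReal.coe_ne_top) (Or.inl hne), mul_div_assoc,
    ENNReal.div_self hne ENNReal.coe_ne_top, mul_one]

/-- The result is fair whatever the bias `a : b` of the coin: a first toss is followed, with
probability `1 / 2`, by a second toss that counts, and otherwise its opposite counts. -/
theorem fair_of_add_eq_one {a b : ℝ≥0∞} (hab : a + b = 1) (x y : ℝ≥0∞) :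
    a * (2⁻¹ * (a * x + b * y) + 2⁻¹ * y) + b * (2⁻¹ * x + 2⁻¹ * (a * x + b * y)) =
      2⁻¹ * x + 2⁻¹ * y :=
  calc _ = (a + b) * (2⁻¹ * (a * x + b * y)) + 2⁻¹ * (a * y + b * x) := by ring
    _ = 1 * (2⁻¹ * (a * x + b * y)) + 2⁻¹ * (a * y + b * x) := by rw [hab]
    _ = 2⁻¹ * ((a + b) * x) + 2⁻¹ * ((a + b) * y) := by ring
    _ = _ := by rw [hab, one_mul, one_mul]

namespace ChainData

open Stage

variable {T K : Type*} {D : ChainData K} {Γs : TileSystem (K × Role) (ℕ × ℕ × Option K)}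
  {e : T → K} {A : Assembly T} {q : ℤ × ℤ} {s : T} {ρ t : K} {z : Role}

theorem place_early {S S' : Stage} {r : Role} {z z' : Role} (hr : S'.Filled r = true)
    (hS : ∀ r', r' ≠ r → S'.Filled r' = S.Filled r') (hz : z = z' ∨ r = contested)
    (hl : r.IsLate = false) :
    (D.partialBlock e A q S ρ t z).place (blockCell q r) (ρ, roleAt z' r) =
      D.partialBlock e A q S' ρ t z' := by
  rw [← place_partialBlock hr hS hz, hl]
  rfl

theorem place_heads_start :
    (D.partialBlock e A q (start 9) ρ t z).place (blockCell q heads) (ρ, heads) =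
      D.partialBlock e A q headsFirst ρ t z :=
  place_early (by decide) (by decide) (Or.inl rfl) rfl

theorem place_tails_start :
    (D.partialBlock e A q (start 9) ρ t z).place (blockCell q tails) (ρ, tails) =
      D.partialBlock e A q tailsFirst ρ t z :=
  place_early (by decide) (by decide) (Or.inl rfl) rfl

theorem place_tails_headsFirst :
    (D.partialBlock e A q headsFirst ρ t z).place (blockCell q tails) (ρ, tails) =
      D.partialBlock e A q undecided ρ t z :=
  place_early (by decide) (by decide) (Or.inl rfl) rfl

theorem place_contested_headsFirst :
    (D.partialBlock e A q headsFirst ρ t z).place (blockCell q contested) (ρ, tails) =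
      D.partialBlock e A q tailsEarly ρ t tails :=
  place_early (z' := tails) (by decide) (by decide) (Or.inr rfl) rfl

theorem place_contested_tailsFirst :
    (D.partialBlock e A q tailsFirst ρ t z).place (blockCell q contested) (ρ, heads) =
      D.partialBlock e A q headsEarly ρ t heads :=
  place_early (z' := heads) (by decide) (by decide) (Or.inr rfl) rfl

theorem place_heads_tailsFirst :
    (D.partialBlock e A q tailsFirst ρ t z).place (blockCell q heads) (ρ, heads) =
      D.partialBlock e A q undecided ρ t z :=
  place_early (by decide) (by decide) (Or.inl rfl) rfl

theorem place_heads_undecided :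
    (D.partialBlock e A q undecided ρ t z).place (blockCell q contested) (ρ, heads) =
      D.partialBlock e A q (final 0) ρ t heads :=
  place_early (z' := heads) (by decide) (by decide) (Or.inr rfl) rfl

theorem place_tails_undecided :
    (D.partialBlock e A q undecided ρ t z).place (blockCell q contested) (ρ, tails) =
      D.partialBlock e A q (final 0) ρ t tails :=
  place_early (z' := tails) (by decide) (by decide) (Or.inr rfl) rfl

theorem place_heads_headsEarly :
    (D.partialBlock e A q headsEarly ρ t z).place (blockCell q heads) (ρ, heads) =
      D.partialBlock e A q (final 0) ρ t z :=
  place_early (by decide) (by decide) (Or.inl rfl) rfl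

theorem place_tails_tailsEarly :
    (D.partialBlock e A q tailsEarly ρ t z).place (blockCell q tails) (ρ, tails) =
      D.partialBlock e A q (final 0) ρ t z :=
  place_early (by decide) (by decide) (Or.inl rfl) rfl

theorem place_late_tailsEarly :
    (D.partialBlock e A q tailsEarly ρ t z).place (blockCell q (0, 0)) (t, (0, 0)) =
      D.partialBlock e A q ⟨9, true, false, true, 1⟩ ρ t z :=
  place_partialBlock (by decide) (by decide) (Or.inl rfl)

theorem place_tails_tailsEarly_late :
    (D.partialBlock e A q ⟨9, true, false, true, 1⟩ ρ t z).place (blockCell q tails) (ρ, tails) =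
      D.partialBlock e A q (final 1) ρ t z :=
  place_early (by decide) (by decide) (Or.inl rfl) rfl

theorem localFrontier_headsFirst_of_not_paired {s : K} (hs : D.next s = some ρ)
    (hpair : ¬D.Paired ρ) :
    D.localFrontier headsFirst ρ t s heads = {(tails, (ρ, tails))} := by
  rw [localFrontier_headsFirst hs]; ext x; simp [hpair]

theorem localFrontier_headsFirst_of_paired {s : K} (hs : D.next s = some ρ)
    (hpair : D.Paired ρ) :
    D.localFrontier headsFirst ρ t s heads =
      {(tails, (ρ, tails)), (contested, (ρ, tails))} := by
  rw [localFrontier_headsFirst hs]; ext x; simp [hpair]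

theorem localFrontier_undecided_of_not_paired {s : K} (hs : D.next s = some ρ)
    (hpair : ¬D.Paired ρ) :
    D.localFrontier undecided ρ t s heads = {(contested, (ρ, heads))} := by
  rw [localFrontier_undecided hs]; ext x; simp [hpair]

theorem localFrontier_undecided_of_paired {s : K} (hs : D.next s = some ρ)
    (hpair : D.Paired ρ) :
    D.localFrontier undecided ρ t s heads =
      {(contested, (ρ, heads)), (contested, (ρ, tails))} := by
  rw [localFrontier_undecided hs]; ext x; simp [hpair]

theorem frontier_eq_empty_of_next_eq_none (h : D.IsGrowing Γs e A q s)
    (hs : D.next (e s) = none) (hp : Γs.Producible (A.blockReplace (D.blocks e))) :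
    Γs.frontier (A.blockReplace (D.blocks e)) = ∅ := by
  rw [← partialBlock_start_zero (ρ := e s) (t := e s) (z := heads) h] at hp ⊢
  rw [frontier_partialBlock h (Or.inl rfl) (by decide) hp, localFrontier_start_of_none hs,
    Set.image_empty]

section Producible

variable (h : D.IsGrowing Γs e A q s)

include h

theorem producible_headsFirst (hp : Γs.Producible (D.partialBlock e A q (start 9) ρ t heads)) :
    Γs.Producible (D.partialBlock e A q headsFirst ρ t heads) := by
  rw [← place_heads_start]
  exact producible_place h (Or.inl rfl) (by decide) hp (by simp [localFrontier_trigger])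

theorem producible_tailsFirst (hp : Γs.Producible (D.partialBlock e A q (start 9) ρ t heads)) :
    Γs.Producible (D.partialBlock e A q tailsFirst ρ t heads) := by
  rw [← place_tails_start]
  exact producible_place h (Or.inl rfl) (by decide) hp (by simp [localFrontier_trigger])

variable (hs : D.next (e s) = some ρ)

include hs

theorem producible_undecided (hp : Γs.Producible (D.partialBlock e A q (start 9) ρ t heads)) :
    Γs.Producible (D.partialBlock e A q undecided ρ t heads) := by
  rw [← place_tails_headsFirst]
  exact producible_place h (Or.inl rfl) (by decide) (producible_headsFirst h hp)
    (by simp [localFrontier_headsFirst hs])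

theorem producible_headsEarly (hp : Γs.Producible (D.partialBlock e A q (start 9) ρ t heads)) :
    Γs.Producible (D.partialBlock e A q headsEarly ρ t heads) := by
  rw [← place_contested_tailsFirst]
  exact producible_place h (Or.inl rfl) (by decide) (producible_tailsFirst h hp)
    (by simp [localFrontier_tailsFirst hs])

theorem producible_tailsEarly (hpair : D.Paired ρ)
    (hp : Γs.Producible (D.partialBlock e A q (start 9) ρ t heads)) :
    Γs.Producible (D.partialBlock e A q tailsEarly ρ t tails) := by
  rw [← place_contested_headsFirst]
  exact producible_place h (Or.inl rfl) (by decide) (producible_headsFirst h hp)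
    (by simp [localFrontier_headsFirst hs, hpair])

theorem producible_final_zero_heads
    (hp : Γs.Producible (D.partialBlock e A q (start 9) ρ t heads)) :
    Γs.Producible (D.partialBlock e A q (final 0) ρ t heads) := by
  rw [← place_heads_undecided]
  exact producible_place h (Or.inl rfl) (by decide) (producible_undecided h hs hp)
    (by simp [localFrontier_undecided hs])

theorem producible_final_zero_tails (hpair : D.Paired ρ)
    (hp : Γs.Producible (D.partialBlock e A q (start 9) ρ t heads)) :
    Γs.Producible (D.partialBlock e A q (final 0) ρ t tails) := by
  rw [← place_tails_undecided]
  exact producible_place h (Or.inl rfl) (by decide) (producible_undecided h hs hp)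
    (by simp [localFrontier_undecided hs, hpair])

end Producible

section Complete

variable (h : D.IsGrowing Γs e A q s)

include h

theorem producible_place_blockReplace_of_heads {u : T} (hρ : D.rep (e u) = e u)
    (hp : Γs.Producible (D.partialBlock e A q (final 0) (e u) t heads)) :
    Γs.Producible ((A.place q u).blockReplace (D.blocks e)) := by
  rw [partialBlock_congr (t' := e u) rfl] at hp
  have hfinal := producible_final h (Or.inl rfl)
    (fun n hn => localFrontier_final_heads hρ hn) hp (n := 8) le_rfl
  have hwinner : D.winner (e u) = heads := by simp [winner, hρ]
  rwa [← partialBlock_final u, hρ, hwinner]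

theorem producible_place_blockReplace_of_tails {v : T} (ht : D.rep (e v) = ρ) (hne : e v ≠ ρ)
    (huniq : ∀ k, D.rep k = ρ → k = ρ ∨ k = e v)
    (hp : Γs.Producible (D.partialBlock e A q (final 0) ρ (e v) tails)) :
    Γs.Producible ((A.place q v).blockReplace (D.blocks e)) := by
  have hfinal := producible_final h (Or.inr rfl)
    (fun n hn => localFrontier_final_tails ht hne huniq hn) hp (n := 8) le_rfl
  have hwinner : D.winner (e v) = tails := by simp [winner, ht, hne.symm]
  rwa [← partialBlock_final v, ht, hwinner]

theorem producible_place_blockReplace {u : T} (hs : D.next (e s) = some (e u))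
    (hρ : D.rep (e u) = e u) (hp : Γs.Producible (A.blockReplace (D.blocks e))) :
    Γs.Producible ((A.place q u).blockReplace (D.blocks e)) := by
  rw [← partialBlock_start_zero (ρ := e u) (t := e u) (z := heads) h] at hp
  exact producible_place_blockReplace_of_heads h hρ
    (producible_final_zero_heads h hs (producible_start h hs hp le_rfl))

theorem producible_place_blockReplace_of_paired {u v : T} (hs : D.next (e s) = some (e u))
    (ht : D.rep (e v) = e u) (hne : e v ≠ e u)
    (huniq : ∀ k, D.rep k = e u → k = e u ∨ k = e v)
    (hp : Γs.Producible (A.blockReplace (D.blocks e))) :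
    Γs.Producible ((A.place q v).blockReplace (D.blocks e)) := by
  rw [← partialBlock_start_zero (ρ := e u) (t := e v) (z := heads) h] at hp
  exact producible_place_blockReplace_of_tails h ht hne huniq
    (producible_final_zero_tails h hs ⟨e v, hne, ht⟩ (producible_start h hs hp le_rfl))

end Complete

section Probability

variable [Fintype K] {C : Concentration (K × Role)} {X : Assembly (K × Role)}
  (h : D.IsGrowing Γs e A q s) (hX : Γs.frontier X = ∅)

include h hX

theorem hit_place_blockReplace_of_heads {u : T} (hρ : D.rep (e u) = e u)
    (hp : Γs.Producible (D.partialBlock e A q (final 0) (e u) t heads)) :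
    Γs.hit C X (D.partialBlock e A q (final 0) (e u) t heads) =
      Γs.hit C X ((A.place q u).blockReplace (D.blocks e)) := by
  rw [partialBlock_congr (t' := e u) rfl] at hp ⊢
  have hwinner : D.winner (e u) = heads := by simp [winner, hρ]
  rw [← partialBlock_final u, hρ, hwinner, hit_final h hX (Or.inl rfl)
    (fun n hn => localFrontier_final_heads hρ hn) hp le_rfl]

theorem hit_place_blockReplace_of_tails {v : T} (ht : D.rep (e v) = ρ) (hne : e v ≠ ρ)
    (huniq : ∀ k, D.rep k = ρ → k = ρ ∨ k = e v)
    (hp : Γs.Producible (D.partialBlock e A q (final 0) ρ (e v) tails)) :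
    Γs.hit C X (D.partialBlock e A q (final 0) ρ (e v) tails) =
      Γs.hit C X ((A.place q v).blockReplace (D.blocks e)) := by
  have hwinner : D.winner (e v) = tails := by simp [winner, ht, hne.symm]
  rw [← partialBlock_final v, ht, hwinner, hit_final h hX (Or.inr rfl)
    (fun n hn => localFrontier_final_tails ht hne huniq hn) hp le_rfl]

theorem hit_headsEarly (hρ : D.rep ρ = ρ)
    (hp : Γs.Producible (D.partialBlock e A q headsEarly ρ t heads)) :
    Γs.hit C X (D.partialBlock e A q headsEarly ρ t heads) =
      Γs.hit C X (D.partialBlock e A q (final 0) ρ t heads) := by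
  have hF := frontier_partialBlock h (Or.inl rfl) (by decide) hp
  rw [localFrontier_headsEarly hρ, Set.image_pair] at hF
  rw [← place_heads_headsEarly]
  refine TileSystem.hit_place_of_enclosed hX hp (hF ▸ Or.inl rfl) ?_ ?_
  · intro b hb
    rw [hF] at hb
    rcases hb with hb | hb
    · exact (Prod.mk.inj hb).2
    · have hcell : heads = (0, 0) := (blockCell_inj.1 (Prod.mk.inj hb).1).2
      exact absurd hcell (by decide)
  · obtain ⟨x₀, a, hA, -⟩ := h.row
    intro d
    rw [partialBlock, cell_neighbor hA]
    cases d <;> simp [look, contents, Filled, rank, IsLate]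

theorem hit_tailsEarly (ht : D.rep t = ρ) (hne : t ≠ ρ)
    (huniq : ∀ k, D.rep k = ρ → k = ρ ∨ k = t)
    (hp : Γs.Producible (D.partialBlock e A q tailsEarly ρ t tails)) :
    Γs.hit C X (D.partialBlock e A q tailsEarly ρ t tails) =
      Γs.hit C X (D.partialBlock e A q (final 0) ρ t tails) := by
  have hF := localFrontier_tailsEarly (s := e s) ht hne huniq
  have hp₀ : Γs.Producible (D.partialBlock e A q (final 0) ρ t tails) := by
    rw [← place_tails_tailsEarly]
    exact producible_place h (Or.inr rfl) (by decide) hp (by simp [hF])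
  have hp₁ : Γs.Producible (D.partialBlock e A q ⟨9, true, false, true, 1⟩ ρ t tails) := by
    rw [← place_late_tailsEarly]
    exact producible_place h (Or.inr rfl) (by decide) hp (by simp [hF])
  refine hit_of_const h hX (Or.inr rfl) (by decide) hp (hF ▸ Set.insert_nonempty _ _) ?_
  rw [hF]
  rintro x (rfl | rfl) <;> dsimp only
  · rw [place_tails_tailsEarly]
  · rw [place_late_tailsEarly,
      hit_forced h hX (Or.inr rfl) (by decide) hp₁ localFrontier_tailsEarly_late,
      place_tails_tailsEarly_late,
      hit_final h hX (Or.inr rfl) (fun n hn => localFrontier_final_tails ht hne huniq hn) hp₀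
        (Nat.le_add_left 1 7)]

variable (hs : D.next (e s) = some ρ)

include hs

theorem hit_undecided_of_not_paired (hpair : ¬D.Paired ρ)
    (hp : Γs.Producible (D.partialBlock e A q undecided ρ t heads)) :
    Γs.hit C X (D.partialBlock e A q undecided ρ t heads) =
      Γs.hit C X (D.partialBlock e A q (final 0) ρ t heads) := by
  rw [hit_forced h hX (Or.inl rfl) (by decide) hp
    (localFrontier_undecided_of_not_paired hs hpair), place_heads_undecided]

theorem hit_trigger_of_not_paired (hρ : D.rep ρ = ρ) (hpair : ¬D.Paired ρ)
    (hp : Γs.Producible (D.partialBlock e A q (start 9) ρ t heads)) :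
    Γs.hit C X (D.partialBlock e A q (start 9) ρ t heads) =
      Γs.hit C X (D.partialBlock e A q (final 0) ρ t heads) := by
  have hundecided := hit_undecided_of_not_paired (C := C) h hX hs hpair
    (producible_undecided h hs hp)
  refine hit_of_const h hX (Or.inl rfl) (by decide) hp
    (localFrontier_trigger ▸ Set.insert_nonempty _ _) ?_
  rw [localFrontier_trigger]
  rintro x (rfl | rfl) <;> dsimp only
  · rw [place_heads_start, hit_forced h hX (Or.inl rfl) (by decide) (producible_headsFirst h hp)
      (localFrontier_headsFirst_of_not_paired hs hpair), place_tails_headsFirst, hundecided]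
  · rw [place_tails_start]
    refine hit_of_const h hX (Or.inl rfl) (by decide) (producible_tailsFirst h hp)
      (localFrontier_tailsFirst hs ▸ Set.insert_nonempty _ _) ?_
    rw [localFrontier_tailsFirst hs]
    rintro x (rfl | rfl) <;> dsimp only
    · rw [place_contested_tailsFirst,
        hit_headsEarly h hX hρ (producible_headsEarly h hs hp)]
    · rw [place_heads_tailsFirst, hundecided]

theorem hit_undecided_of_paired (hpair : D.Paired ρ)
    (hp : Γs.Producible (D.partialBlock e A q undecided ρ t heads)) :
    Γs.hit C X (D.partialBlock e A q undecided ρ t heads) =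
      C.conc (ρ, heads) / (C.conc (ρ, heads) + C.conc (ρ, tails)) *
        Γs.hit C X (D.partialBlock e A q (final 0) ρ t heads) +
      C.conc (ρ, tails) / (C.conc (ρ, heads) + C.conc (ρ, tails)) *
        Γs.hit C X (D.partialBlock e A q (final 0) ρ t tails) := by
  rw [hit_of_pair h hX (Or.inl rfl) (by decide) hp (by simp)
    (localFrontier_undecided_of_paired hs hpair), place_heads_undecided, place_tails_undecided]

theorem hit_headsFirst_of_paired (ht : D.rep t = ρ) (hne : t ≠ ρ)
    (huniq : ∀ k, D.rep k = ρ → k = ρ ∨ k = t)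
    (hp : Γs.Producible (D.partialBlock e A q (start 9) ρ t heads)) :
    Γs.hit C X (D.partialBlock e A q headsFirst ρ t heads) =
      2⁻¹ * Γs.hit C X (D.partialBlock e A q undecided ρ t heads) +
      2⁻¹ * Γs.hit C X (D.partialBlock e A q (final 0) ρ t tails) := by
  have hpair : D.Paired ρ := ⟨t, hne, ht⟩
  rw [hit_of_pair h hX (Or.inl rfl) (by decide) (producible_headsFirst h hp) (by simp)
    (localFrontier_headsFirst_of_paired hs hpair), place_tails_headsFirst,
    place_contested_headsFirst, div_add_self_eq (C.conc_pos _),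
    hit_tailsEarly h hX ht hne huniq (producible_tailsEarly h hs hpair hp)]

theorem hit_tailsFirst (hρ : D.rep ρ = ρ)
    (hp : Γs.Producible (D.partialBlock e A q (start 9) ρ t heads)) :
    Γs.hit C X (D.partialBlock e A q tailsFirst ρ t heads) =
      2⁻¹ * Γs.hit C X (D.partialBlock e A q (final 0) ρ t heads) +
      2⁻¹ * Γs.hit C X (D.partialBlock e A q undecided ρ t heads) := by
  rw [hit_of_pair h hX (Or.inl rfl) (by decide) (producible_tailsFirst h hp) (by simp)
    (localFrontier_tailsFirst hs), place_contested_tailsFirst, place_heads_tailsFirst,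
    div_add_self_eq (C.conc_pos _), hit_headsEarly h hX hρ (producible_headsEarly h hs hp)]

theorem hit_trigger_of_paired (hρ : D.rep ρ = ρ) (ht : D.rep t = ρ) (hne : t ≠ ρ)
    (huniq : ∀ k, D.rep k = ρ → k = ρ ∨ k = t)
    (hp : Γs.Producible (D.partialBlock e A q (start 9) ρ t heads)) :
    Γs.hit C X (D.partialBlock e A q (start 9) ρ t heads) =
      2⁻¹ * Γs.hit C X (D.partialBlock e A q (final 0) ρ t heads) +
      2⁻¹ * Γs.hit C X (D.partialBlock e A q (final 0) ρ t tails) := by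
  rw [hit_of_pair h hX (Or.inl rfl) (by decide) hp (by simp) localFrontier_trigger,
    place_heads_start, place_tails_start, hit_headsFirst_of_paired h hX hs ht hne huniq hp,
    hit_tailsFirst h hX hs hρ hp,
    hit_undecided_of_paired h hX hs ⟨t, hne, ht⟩ (producible_undecided h hs hp)]
  exact fair_of_add_eq_one (div_add_div_eq_one (C.conc_pos _)) _ _

end Probability

section Step

variable [Fintype K] {C : Concentration (K × Role)} {X : Assembly (K × Role)}

theorem hit_of_not_paired (h : D.IsGrowing Γs e A q s) (hX : Γs.frontier X = ∅) {u : T}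
    (hs : D.next (e s) = some (e u)) (hρ : D.rep (e u) = e u) (hpair : ¬D.Paired (e u))
    (hp : Γs.Producible (A.blockReplace (D.blocks e))) :
    Γs.hit C X (A.blockReplace (D.blocks e)) =
      Γs.hit C X ((A.place q u).blockReplace (D.blocks e)) := by
  rw [← partialBlock_start_zero (ρ := e u) (t := e u) (z := heads) h] at hp ⊢
  have hp' := producible_start h hs hp le_rfl
  rw [hit_start h hX hs hp le_rfl, hit_trigger_of_not_paired h hX hs hρ hpair hp',
    hit_place_blockReplace_of_heads h hX hρ (producible_final_zero_heads h hs hp')]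

theorem hit_of_paired (h : D.IsGrowing Γs e A q s) (hX : Γs.frontier X = ∅) {u v : T}
    (hs : D.next (e s) = some (e u)) (hρ : D.rep (e u) = e u) (ht : D.rep (e v) = e u)
    (hne : e v ≠ e u) (huniq : ∀ k, D.rep k = e u → k = e u ∨ k = e v)
    (hp : Γs.Producible (A.blockReplace (D.blocks e))) :
    Γs.hit C X (A.blockReplace (D.blocks e)) =
      2⁻¹ * Γs.hit C X ((A.place q u).blockReplace (D.blocks e)) +
      2⁻¹ * Γs.hit C X ((A.place q v).blockReplace (D.blocks e)) := by
  rw [← partialBlock_start_zero (ρ := e u) (t := e v) (z := heads) h] at hp ⊢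
  have hp' := producible_start h hs hp le_rfl
  rw [hit_start h hX hs hp le_rfl, hit_trigger_of_paired h hX hs hρ ht hne huniq hp',
    hit_place_blockReplace_of_heads h hX hρ (producible_final_zero_heads h hs hp'),
    hit_place_blockReplace_of_tails h hX ht hne huniq
      (producible_final_zero_tails h hs ⟨e v, hne, ht⟩ hp')]

end Step

end ChainData

/-! ### Stability of complete blocks -/

/-- Bonds in the blocks of the simulation that have strength `2`, as triples of a cell, a side of
it, and the cell at this side. They form two paths, one of them through the late cells. -/
def Role.strongBonds : List (Role × Side × Role) :=
  [((0, 3), .east, (1, 3)), ((1, 3), .east, (2, 3)), ((2, 3), .east, (3, 3)),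
    ((3, 3), .south, (3, 2)), ((3, 2), .south, (3, 1)), ((3, 1), .west, (2, 1)),
    ((2, 1), .north, (2, 2)), ((2, 2), .west, (1, 2)), ((1, 0), .east, (2, 0)),
    ((2, 0), .east, (3, 0)), ((3, 0), .east, (4, 0)), ((4, 0), .north, (4, 1)),
    ((4, 1), .north, (4, 2)), ((4, 2), .north, (4, 3))]

/-- Further bonds in the blocks of the simulation. -/
def Role.weakBonds : List (Role × Side × Role) :=
  [((1, 1), .north, (1, 2)), ((1, 1), .east, (2, 1)), ((0, 2), .north, (0, 3)),
    ((0, 2), .east, (1, 2)), ((0, 1), .south, (0, 0)), ((0, 0), .east, (1, 0)),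
    ((1, 0), .north, (1, 1))]

/-- The possible bonds of the tile at the contested cell with `heads` and `tails`. In a complete
block, at least one of them is present. -/
def Role.contestedBonds : List (Role × Side × Role) :=
  [(contested, .east, tails), (contested, .north, heads)]

theorem Role.iff_entry_of_bonds {M : Role → Prop} {x : Role × Side × Role}
    (hx : x ∈ contestedBonds) (strong : ∀ y ∈ strongBonds, M y.1 ↔ M y.2.2)
    (weak : (x :: weakBonds).Pairwise fun y z => (M y.1 ↔ M y.2.2) ∨ (M z.1 ↔ M z.2.2))
    (r : Role) : M r ↔ M (0, 3) := by
  have hx' : x.1 = contested ∧ (x.2.2 = tails ∨ x.2.2 = heads) := by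
    revert x; simp [contestedBonds]
  simp only [strongBonds, List.forall_mem_cons, List.not_mem_nil, false_imp_iff, implies_true,
    and_true] at strong
  simp only [weakBonds, List.pairwise_cons, List.forall_mem_cons, List.not_mem_nil, false_imp_iff,
    implies_true, and_true, List.Pairwise.nil] at weak
  have htails : M tails ↔ M (0, 3) := by grind
  have hheads : M heads ↔ M (0, 3) := by grind
  have hcontested : M contested ↔ M (0, 3) := by grind
  have hlate : M (1, 0) ↔ M (0, 3) := by grind
  obtain ⟨i, j⟩ := r
  fin_cases i <;> fin_cases j <;> simp <;> grind

namespace ChainData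

variable {T K : Type*} {D : ChainData K} {e : T → K} {A : Assembly T} {q : ℤ × ℤ} {s t : T}

section Bonds

variable (D) (k : K)

attribute [local simp] bondWith_glue block glueData label labelTable sideIndex IsLate roleAt
  Side.opp labelStr

theorem two_le_bond_block : ∀ x ∈ strongBonds,
    2 ≤ bondWith D.glue glueStr (D.block k x.1) x.2.1 (some (D.block k x.2.2)) := by
  simp [strongBonds]

theorem one_le_bond_block : ∀ x ∈ weakBonds,
    1 ≤ bondWith D.glue glueStr (D.block k x.1) x.2.1 (some (D.block k x.2.2)) := by
  by_cases h : D.rep k = k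
  · simp [weakBonds, h, winner]
  · simp [weakBonds, h, winner]

theorem exists_one_le_bond_contested : ∃ x ∈ contestedBonds,
    1 ≤ bondWith D.glue glueStr (D.block k x.1) x.2.1 (some (D.block k x.2.2)) := by
  by_cases h : D.rep k = k
  · by_cases hp : D.Paired k <;> simp [contestedBonds, h, hp, winner]
  · have hp : D.Paired (D.rep k) := ⟨k, Ne.symm h, rfl⟩
    simp [contestedBonds, h, hp, winner]

theorem two_le_bond_exit {k' : K} (h : D.next k = some (D.rep k')) :
    2 ≤ bondWith D.glue glueStr (D.block k (4, 3)) .east (some (D.block k' (0, 3))) := by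
  simp [h]

end Bonds

theorem blockCell_add_vec_of_mem_bonds (q : ℤ × ℤ) :
    ∀ x ∈ strongBonds ++ weakBonds ++ contestedBonds,
      blockCell q x.1 + x.2.1.vec = blockCell q x.2.2 := by
  intro x hx
  have hzero : ∀ x ∈ strongBonds ++ weakBonds ++ contestedBonds,
      blockCell 0 x.1 + x.2.1.vec = blockCell 0 x.2.2 := by decide +kernel
  simpa only [blockCell, Prod.ext_iff, Prod.fst_add, Prod.snd_add, Prod.fst_zero, Prod.snd_zero,
    mul_zero, zero_add, add_assoc, add_right_inj] using hzero x hx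

theorem blockCell_exit_add_vec (x y : ℤ) :
    blockCell (x, y) (4, 3) + Side.east.vec = blockCell (x + 1, y) (0, 3) := by
  rw [blockCell_add_vec]; simp [Side.vec]

theorem bond_blockReplace (ht : A.cell q = some t) {x : Role × Side × Role}
    (hx : x ∈ strongBonds ++ weakBonds ++ contestedBonds) :
    (A.blockReplace (D.blocks e)).bond D.glue glueStr (blockCell q x.1) (blockCell q x.2.2) =
      bondWith D.glue glueStr (D.block (e t) x.1) x.2.1 (some (D.block (e t) x.2.2)) := by
  have hcell (r : Role) :
      (A.blockReplace (D.blocks e)).cell (blockCell q r) = some (D.block (e t) r) := by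
    rw [cell_blockReplace, ht]; rfl
  rw [← blockCell_add_vec_of_mem_bonds q x hx, bond_add_vec _ _ (hcell _),
    blockCell_add_vec_of_mem_bonds q x hx, hcell]

theorem mem_iff_mem_entry {S : Finset (ℤ × ℤ)}
    (hS : (A.blockReplace (D.blocks e)).cutWeight D.glue glueStr S < 2)
    (ht : A.cell q = some t) (r : Role) : blockCell q r ∈ S ↔ blockCell q (0, 3) ∈ S := by
  obtain ⟨x, hx, hbond⟩ := D.exists_one_le_bond_contested (e t)
  refine Role.iff_entry_of_bonds (M := fun r => blockCell q r ∈ S) hx (fun y hy => ?_) ?_ r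
  · refine mem_iff_of_cutWeight_lt (hS.trans_le ?_)
    rw [bond_blockReplace ht (by simp [hy])]
    exact D.two_le_bond_block (e t) y hy
  have hweak : ∀ y ∈ x :: weakBonds, 1 ≤ (A.blockReplace (D.blocks e)).bond D.glue glueStr
      (blockCell q y.1) (blockCell q y.2.2) := by
    refine List.forall_mem_cons.2 ⟨?_, fun y hy => ?_⟩
    · rwa [bond_blockReplace ht (by simp [hx])]
    · rw [bond_blockReplace ht (by simp [hy])]
      exact D.one_le_bond_block (e t) y hy
  have hdistinct : (x :: weakBonds).Pairwise fun y z => s(y.1, y.2.2) ≠ s(z.1, z.2.2) := by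
    clear hbond hweak
    revert x; decide +kernel
  refine hdistinct.imp_of_mem fun {y z} hy hz hne => ?_
  refine mem_iff_or_mem_iff_of_cutWeight_lt
    (hS.trans_le (add_le_add (hweak y hy) (hweak z hz))) ?_
  simpa [blockCell_inj] using hne

theorem mem_entry_iff_of_next {S : Finset (ℤ × ℤ)}
    (hS : (A.blockReplace (D.blocks e)).cutWeight D.glue glueStr S < 2) {x y : ℤ}
    (hs : A.cell (x, y) = some s) (ht : A.cell (x + 1, y) = some t)
    (hnext : D.next (e s) = some (D.rep (e t))) :
    blockCell (x + 1, y) (0, 3) ∈ S ↔ blockCell (x, y) (0, 3) ∈ S := by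
  rw [← mem_iff_mem_entry hS hs (4, 3)]
  refine (mem_iff_of_cutWeight_lt (hS.trans_le ?_)).symm
  rw [← blockCell_exit_add_vec, bond_add_vec (a := D.block (e s) (4, 3)), blockCell_exit_add_vec,
    cell_blockReplace, ht]
  · exact D.two_le_bond_exit (e s) hnext
  · rw [cell_blockReplace, hs]; rfl

theorem stable_blockReplace {x₀ : ℤ} {a : T} (hA : IsRow A x₀ q a s)
    (hnext : ∀ x s t, A.cell (x, q.2) = some s → A.cell (x + 1, q.2) = some t →
      D.next (e s) = some (D.rep (e t))) :
    (A.blockReplace (D.blocks e)).Stable D.glue glueStr 2 := by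
  intro S hsub hne hneq
  by_contra! hS
  have htile (x : ℤ) (h₁ : x₀ ≤ x) (h₂ : x < q.1) : ∃ t, A.cell (x, q.2) = some t :=
    Option.ne_none_iff_exists'.1 ((hA.cell_ne (x, q.2)).2 ⟨rfl, h₁, h₂⟩)
  have hentry (x : ℤ) (h₁ : x₀ ≤ x) :
      x < q.1 → (blockCell (x, q.2) (0, 3) ∈ S ↔ blockCell (x₀, q.2) (0, 3) ∈ S) := by
    induction x, h₁ using Int.leInduction with
    | base => exact fun _ => Iff.rfl
    | succ x h₁ ih =>
      intro h₂
      obtain ⟨s, hs⟩ := htile x h₁ (by lia)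
      obtain ⟨t, ht⟩ := htile (x + 1) (by lia) h₂
      exact (mem_entry_iff_of_next hS hs ht (hnext x s t hs ht)).trans (ih (by lia))
  have hall : ∀ p ∈ (A.blockReplace (D.blocks e)).dom,
      (p ∈ S ↔ blockCell (x₀, q.2) (0, 3) ∈ S) := by
    intro p hp
    rw [mem_dom, ← blockCell_blockOf_roleOf p, cell_blockReplace, ne_eq,
      Option.map_eq_none_iff] at hp
    obtain ⟨hrow, h₁, h₂⟩ := (hA.cell_ne _).1 hp
    obtain ⟨t, ht⟩ := Option.ne_none_iff_exists'.1 hp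
    rw [← hentry _ h₁ h₂, ← hrow, ← mem_iff_mem_entry hS ht (roleOf p), blockCell_blockOf_roleOf]
  by_cases h₀ : blockCell (x₀, q.2) (0, 3) ∈ S
  · exact hneq (hsub.antisymm fun p hp => (hall p hp).2 h₀)
  · obtain ⟨p, hp⟩ := hne
    exact h₀ ((hall p (hsub hp)).1 hp)

end ChainData

/-! ### Rows of tiles -/

section Row

variable {T G : Type*} {A : Assembly T} {x₀ : ℤ} {q : ℤ × ℤ} {a s t : T}

namespace Assembly

theorem exists_eq_add_vec_of_bond_ne_zero {glue : T → Side → G} {str : G → ℕ} {p p' : ℤ × ℤ}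
    (h : A.bond glue str p p' ≠ 0) : ∃ d : Side, p' = p + d.vec := by
  by_contra! hne
  revert h
  unfold bond
  split <;> simp [hne]

theorem exists_isRow (hA : A.dom.Nonempty) {n : ℕ} (h : A.IsLine n) :
    ∃ x₀ q a s, IsRow A x₀ q a s := by
  obtain ⟨x, y, h⟩ := h
  obtain ⟨p, hp⟩ := hA
  have hp' := (h p).1 hp
  obtain ⟨a, ha⟩ := Option.ne_none_iff_exists'.1 (mem_dom.1 ((h (x, y)).2 ⟨rfl, le_rfl, by lia⟩))
  obtain ⟨s, hs⟩ := Option.ne_none_iff_exists'.1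
    (mem_dom.1 ((h (x + n - 1, y)).2 ⟨rfl, by simp only; lia, by simp only; lia⟩))
  exact ⟨x, (x + n, y), a, s, fun p => by rw [← mem_dom, h], ha, hs⟩

end Assembly

namespace IsRow

theorem place (hA : IsRow A x₀ q a s) (t : T) :
    IsRow (A.place q t) x₀ (q + Side.east.vec) a t where
  cell_ne := by
    have hlt := hA.lt
    intro p
    rw [← mem_dom, dom_place, Finset.mem_insert, mem_dom, hA.cell_ne]
    simp only [Prod.ext_iff, Side.vec, Prod.fst_add, Prod.snd_add]
    lia
  first := by
    rw [cell_place_of_ne]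
    · simpa [Side.vec] using hA.first
    · exact fun h => hA.lt.ne (congrArg Prod.fst h)
  last := by
    have hlast : ((q + Side.east.vec).1 - 1, (q + Side.east.vec).2) = q := by simp [Side.vec]
    rw [hlast, cell_place_self]

theorem cutWeight_filter_le (hA : IsRow A x₀ q a s) (glue : T → Side → G) (str : G → ℕ) {x : ℤ}
    (h₀ : x₀ ≤ x) (hx : x + 1 < q.1) :
    A.cutWeight glue str (A.dom.filter fun p => p.1 ≤ x) =
      A.bond glue str (x, q.2) (x + 1, q.2) := by
  have hdom {p : ℤ × ℤ} : p ∈ A.dom ↔ p.2 = q.2 ∧ x₀ ≤ p.1 ∧ p.1 < q.1 := by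
    rw [mem_dom, hA.cell_ne]
  have hzero {p p' : ℤ × ℤ} (hp : p ∈ A.dom) (hp' : p' ∈ A.dom) (hpx : p.1 ≤ x) (hpx' : x < p'.1)
      (hne : p ≠ (x, q.2) ∨ p' ≠ (x + 1, q.2)) : A.bond glue str p p' = 0 := by
    by_contra hbond
    obtain ⟨d, rfl⟩ := exists_eq_add_vec_of_bond_ne_zero hbond
    rw [hdom] at hp hp'
    cases d <;>
      simp only [Side.vec, ne_eq, Prod.ext_iff, Prod.fst_add,
        Prod.snd_add] at hp hp' hpx hpx' hne <;>
      lia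
  rw [cutWeight, Finset.sum_eq_single_of_mem (x, q.2) (by simp [hdom]; lia),
    Finset.sum_eq_single_of_mem (x + 1, q.2) (by simp [hdom]; lia)]
  · intro p' hp' hne
    rw [Finset.mem_sdiff, Finset.mem_filter, not_and, not_le] at hp'
    exact hzero (by simp [hdom]; lia) hp'.1 le_rfl (hp'.2 hp'.1) (Or.inr hne)
  · intro p hp hne
    refine Finset.sum_eq_zero fun p' hp' => ?_
    rw [Finset.mem_filter] at hp
    rw [Finset.mem_sdiff, Finset.mem_filter, not_and, not_le] at hp'
    exact hzero hp.1 hp'.1 hp.2 (hp'.2 hp'.1) (Or.inl hne)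

theorem attachWeight_east (hA : IsRow A x₀ q a s) (glue : T → Side → G) (str : G → ℕ) (t : T) :
    A.attachWeight glue str q t = bondWith glue str t .west (some s) := by
  have hwest : q + Side.west.vec = (q.1 - 1, q.2) := by ext <;> simp [Side.vec, sub_eq_add_neg]
  rw [attachWeight, Side.sum_eq, hwest, hA.last,
    hA.cell_eq_none (p := q + Side.north.vec) (by simp [Side.vec]),
    hA.cell_eq_none (p := q + Side.east.vec) (by simp [Side.vec]),
    hA.cell_eq_none (p := q + Side.south.vec) (by simp [Side.vec])]
  simp [bondWith_none]

theorem attachWeight_west (hA : IsRow A x₀ q a s) (glue : T → Side → G) (str : G → ℕ) (t : T) :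
    A.attachWeight glue str (x₀ - 1, q.2) t = bondWith glue str t .east (some a) := by
  have heast : ((x₀ - 1, q.2) : ℤ × ℤ) + Side.east.vec = (x₀, q.2) := by simp [Side.vec]
  rw [attachWeight, Side.sum_eq, heast, hA.first,
    hA.cell_eq_none (p := _ + Side.north.vec) (by simp [Side.vec]),
    hA.cell_eq_none (p := _ + Side.west.vec) (by simp [Side.vec]),
    hA.cell_eq_none (p := _ + Side.south.vec) (by simp [Side.vec])]
  simp [bondWith_none]

theorem eq_or_eq_of_isLine_place (hA : IsRow A x₀ q a s) {p : ℤ × ℤ} (hp : A.cell p = none) {n : ℕ}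
    (h : (A.place p t).IsLine n) : p = q ∨ p = (x₀ - 1, q.2) := by
  obtain ⟨x, y, hline⟩ := h
  have hrow (p' : ℤ × ℤ) : (p' = p ∨ p'.2 = q.2 ∧ x₀ ≤ p'.1 ∧ p'.1 < q.1) ↔
      p'.2 = y ∧ x ≤ p'.1 ∧ p'.1 < x + n := by
    rw [← hline, dom_place, Finset.mem_insert, mem_dom, hA.cell_ne]
  have hpA : ¬(p.2 = q.2 ∧ x₀ ≤ p.1 ∧ p.1 < q.1) := fun h => (hA.cell_ne p).2 h hp
  have hlt := hA.lt
  have hpline := (hrow p).1 (Or.inl rfl)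
  have hfirst := hrow (x₀, q.2)
  have hbefore := hrow (x₀ - 1, q.2)
  have hafter := hrow q
  have hlast := hrow (q.1 - 1, q.2)
  simp only [Prod.ext_iff] at hpline hfirst hbefore hafter hlast ⊢
  lia

end IsRow

end Row

namespace TileSystem

variable {T G : Type*} {Γ : TileSystem T G}

/-- A tile of type `t` can be attached to the east of a tile of type `s`. -/
def Joins (Γ : TileSystem T G) (s t : T) : Prop :=
  Γ.glue s .east = Γ.glue t .west ∧ Γ.temperature ≤ Γ.str (Γ.glue s .east)

variable {A : Assembly T} {x₀ : ℤ} {q : ℤ × ℤ} {a s s' t : T}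

theorem temperature_le_bondWith_west :
    Γ.temperature ≤ bondWith Γ.glue Γ.str t .west (some s) ↔ Γ.Joins s t := by
  have := Γ.temperature_pos
  rw [bondWith_some, Joins, eq_comm, Side.opp]
  split_ifs with h
  · rw [h]; simp
  · simp [h]; lia

theorem temperature_le_bondWith_east :
    Γ.temperature ≤ bondWith Γ.glue Γ.str s .east (some t) ↔ Γ.Joins s t := by
  have := Γ.temperature_pos
  rw [bondWith_some, Joins, Side.opp]
  split_ifs with h
  · simp [h]
  · simp [h]; lia

theorem joins_of_stable (hA : IsRow A x₀ q a s')
    (hstable : A.Stable Γ.glue Γ.str Γ.temperature) {x : ℤ}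
    (hs : A.cell (x, q.2) = some s) (ht : A.cell (x + 1, q.2) = some t) : Γ.Joins s t := by
  have hx := (hA.cell_ne (x, q.2)).1 (by simp [hs])
  have hx' := (hA.cell_ne (x + 1, q.2)).1 (by simp [ht])
  have heast : ((x, q.2) : ℤ × ℤ) + Side.east.vec = (x + 1, q.2) := by simp [Side.vec]
  have hcut := stable_iff_le_cutWeight.1 hstable (A.dom.filter fun p => p.1 ≤ x)
    (Finset.filter_subset _ _) ⟨(x, q.2), by simp [mem_dom, hs]⟩ fun h => by
      have hmem : (x + 1, q.2) ∈ A.dom := by simp [mem_dom, ht]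
      rw [← h] at hmem
      simp at hmem
  rwa [hA.cutWeight_filter_le _ _ hx.2.1 hx'.2.2, ← heast, bond_add_vec _ _ hs, heast, ht,
    temperature_le_bondWith_east] at hcut

theorem mem_frontier_iff_joins (hΓ : Γ.IsUnidirectionalTwoChoiceLinear) (hA : IsRow A x₀ q a s)
    (hp : Γ.Producible A) (ha : ∀ t, ¬Γ.Joins t a) {p : ℤ × ℤ} :
    (p, t) ∈ Γ.frontier A ↔ p = q ∧ Γ.Joins s t := by
  constructor
  · intro hf
    obtain ⟨hnone, hweight⟩ := hp.mem_frontier_iff.1 hf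
    obtain ⟨n, hline⟩ := hΓ.linear _ (hp.attach hf)
    rcases hA.eq_or_eq_of_isLine_place hnone hline with rfl | rfl
    · rw [hA.attachWeight_east, temperature_le_bondWith_west] at hweight
      exact ⟨rfl, hweight⟩
    · rw [hA.attachWeight_west, temperature_le_bondWith_east] at hweight
      exact absurd hweight (ha t)
  · rintro ⟨rfl, hjoins⟩
    rw [hp.mem_frontier_iff, hA.attachWeight_east, temperature_le_bondWith_west]
    exact ⟨hA.cell_eq_none (by simp), hjoins⟩

/-- The seed is a row that cannot grow at its west end. -/
def IsEastward (Γ : TileSystem T G) : Prop :=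
  ∃ x₀ q a s, IsRow Γ.seed x₀ q a s ∧ ∀ t, ¬Γ.Joins t a

theorem Producible.exists_isRow (hΓ : Γ.IsUnidirectionalTwoChoiceLinear) (he : Γ.IsEastward)
    (hA : Γ.Producible A) : ∃ x₀ q a s, IsRow A x₀ q a s ∧ ∀ t, ¬Γ.Joins t a := by
  induction hA with
  | seed => exact he
  | attach hA hf ih =>
    obtain ⟨x₀, q, a, s, hrow, ha⟩ := ih
    obtain ⟨rfl, -⟩ := (mem_frontier_iff_joins hΓ hrow hA ha).1 hf
    exact ⟨x₀, _, a, _, hrow.place _, ha⟩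

end TileSystem

/-! ### The simulation -/

theorem Assembly.card_dom_blockReplace {T T' : Type*} (R : T → Fin 5 → Fin 4 → T')
    (A : Assembly T) : (A.blockReplace R).dom.card = A.dom.card * 20 := by
  classical
  have hdom : (A.blockReplace R).dom =
      (A.dom ×ˢ (Finset.univ : Finset Role)).image fun x => blockCell x.1 x.2 := by
    ext p
    rw [← blockCell_blockOf_roleOf p, mem_dom, cell_blockReplace]
    simp only [Finset.mem_image, Finset.mem_product, Finset.mem_univ, and_true, blockCell_inj,
      mem_dom, ne_eq, Option.map_eq_none_iff]
    constructor
    · exact fun h => ⟨(blockOf p, roleOf p), h, rfl, rfl⟩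
    · rintro ⟨⟨q, r⟩, h, rfl, rfl⟩
      exact h
  rw [hdom, Finset.card_image_of_injective, Finset.card_product]
  · rfl
  · exact fun x y h => Prod.ext_iff.2 (blockCell_inj.1 h)

theorem ChainData.blockReplace_injective {T K : Type*} (D : ChainData K) {e : T → K}
    (he : Function.Injective e) :
    Function.Injective fun A : Assembly T => A.blockReplace (D.blocks e) := by
  intro A B h
  ext1
  funext q
  have hexit := congrArg (fun A => A.cell (blockCell q (4, 3))) h
  simp only [cell_blockReplace] at hexit
  refine Option.map_injective (fun s t hst => he ?_) hexit
  simpa [blocks, block, IsLate] using congrArg Prod.fst hst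

namespace TileSystem

variable {T G K : Type*} {Γ : TileSystem T G}

/-- The system `Γs` has the tile types and the seed that simulate the system `Γ`, whose assemblies
are rows that grow to the east. The tile types of `Γ` are identified with the data in `K`. -/
structure IsSimulation (D : ChainData K) (Γ : TileSystem T G) (e : T ≃ K)
    (Γs : TileSystem (K × Role) (ℕ × ℕ × Option K)) : Prop where
  linear : Γ.IsUnidirectionalTwoChoiceLinear
  eastward : Γ.IsEastward
  sim : D.IsSimulator Γs
  seed_eq : Γs.seed = Γ.seed.blockReplace (D.blocks e)
  rep_rep : ∀ k, D.rep (D.rep k) = D.rep k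
  next_eq_some_iff : ∀ s t, D.next (e s) = some (D.rep (e t)) ↔ Γ.Joins s t
  next_eq_none : ∀ s, (∀ t, ¬Γ.Joins s t) → D.next (e s) = none

namespace IsSimulation

variable {D : ChainData K} {e : T ≃ K} {Γs : TileSystem (K × Role) (ℕ × ℕ × Option K)}
  {A : Assembly T} {X : Assembly (K × Role)}

theorem exists_isGrowing (h : IsSimulation D Γ e Γs) (hA : Γ.Producible A) :
    ∃ q s, D.IsGrowing Γs e A q s ∧ ∀ p t, (p, t) ∈ Γ.frontier A ↔ p = q ∧ Γ.Joins s t := by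
  obtain ⟨x₀, q, a, s, hrow, ha⟩ := hA.exists_isRow h.linear h.eastward
  refine ⟨q, s, ⟨h.sim, x₀, a, hrow, fun k hk => ?_⟩,
    fun p t => mem_frontier_iff_joins h.linear hrow hA ha⟩
  obtain ⟨t, rfl⟩ := e.surjective k
  exact ha t ((h.next_eq_some_iff t a).1 hk)

theorem frontier_blockReplace_eq_empty (h : IsSimulation D Γ e Γs) (hA : Γ.Producible A)
    (hA' : Γs.Producible (A.blockReplace (D.blocks e))) (hempty : Γ.frontier A = ∅) :
    Γs.frontier (A.blockReplace (D.blocks e)) = ∅ := by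
  obtain ⟨q, s, hgrow, hfrontier⟩ := h.exists_isGrowing hA
  refine ChainData.frontier_eq_empty_of_next_eq_none hgrow (h.next_eq_none s fun t ht => ?_) hA'
  exact Set.eq_empty_iff_forall_notMem.1 hempty (q, t) ((hfrontier q t).2 ⟨rfl, ht⟩)

theorem exists_rep_eq_self (h : IsSimulation D Γ e Γs) {s t : T} (ht : Γ.Joins s t) :
    ∃ u, D.next (e s) = some (e u) ∧ D.rep (e u) = e u ∧
      ∀ v, Γ.Joins s v ↔ D.rep (e v) = e u := by
  obtain ⟨u, hu⟩ := e.surjective (D.rep (e t))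
  have hs : D.next (e s) = some (e u) := by rw [hu, h.next_eq_some_iff]; exact ht
  refine ⟨u, hs, by rw [hu, h.rep_rep], fun v => ?_⟩
  rw [← h.next_eq_some_iff, hs, Option.some_inj, eq_comm]

theorem frontier_cases (h : IsSimulation D Γ e Γs) (hA : Γ.Producible A)
    (hne : (Γ.frontier A).Nonempty) :
    ∃ q s u, D.IsGrowing Γs e A q s ∧ D.next (e s) = some (e u) ∧ D.rep (e u) = e u ∧
      (¬D.Paired (e u) ∧ Γ.frontier A = {(q, u)} ∨
        ∃ v, D.rep (e v) = e u ∧ e v ≠ e u ∧ (∀ k, D.rep k = e u → k = e u ∨ k = e v) ∧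
          Γ.frontier A = {(q, u), (q, v)}) := by
  obtain ⟨q, s, hgrow, hfrontier⟩ := h.exists_isGrowing hA
  obtain ⟨⟨p, t⟩, hpt⟩ := hne
  obtain ⟨u, hs, hu, hjoins⟩ := h.exists_rep_eq_self ((hfrontier p t).1 hpt).2
  simp only [hjoins] at hfrontier
  refine ⟨q, s, u, hgrow, hs, hu, ?_⟩
  by_cases hpair : D.Paired (e u)
  · obtain ⟨k, hne, hk⟩ := hpair
    obtain ⟨v, rfl⟩ := e.surjective k
    have hpair : Γ.frontier A = {(q, u), (q, v)} := by
      refine (Set.Finite.eq_of_subset_of_encard_le (Set.toFinite _) ?_ ?_).symm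
      · rintro x (rfl | rfl)
        exacts [(hfrontier _ _).2 ⟨rfl, hu⟩, (hfrontier _ _).2 ⟨rfl, hk⟩]
      · rw [Set.encard_pair fun huv => hne (congrArg (fun x => e x.2) huv).symm]
        exact h.linear.two_choice A hA
    refine Or.inr ⟨v, hk, hne, fun k hk' => ?_, hpair⟩
    obtain ⟨w, rfl⟩ := e.surjective k
    simpa [hpair] using (hfrontier q w).2 ⟨rfl, hk'⟩
  · refine Or.inl ⟨hpair, Set.ext fun ⟨p, w⟩ => ?_⟩
    rw [hfrontier, Set.mem_singleton_iff, Prod.mk_inj (a₁ := p)]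
    refine and_congr_right fun _ => ⟨fun hw => ?_, fun hw => by rw [hw, hu]⟩
    exact e.injective (not_imp_comm.1 (fun hne => ⟨e w, hne, hw⟩) hpair)

theorem producible_blockReplace (h : IsSimulation D Γ e Γs) (hA : Γ.Producible A) :
    Γs.Producible (A.blockReplace (D.blocks e)) := by
  induction hA with
  | seed => exact h.seed_eq ▸ Producible.seed
  | attach hA hf ih =>
    obtain ⟨q, s, u, hgrow, hs, hu, ⟨-, hfrontier⟩ | ⟨v, hv, hne, huniq, hfrontier⟩⟩ :=
      h.frontier_cases hA ⟨_, hf⟩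
    · obtain ⟨rfl, rfl⟩ := Prod.mk_inj.1 (hfrontier.subset hf)
      exact ChainData.producible_place_blockReplace hgrow hs hu ih
    · rcases hfrontier.subset hf with hf | hf <;> obtain ⟨rfl, rfl⟩ := Prod.mk_inj.1 hf
      · exact ChainData.producible_place_blockReplace hgrow hs hu ih
      · exact ChainData.producible_place_blockReplace_of_paired hgrow hs hv hne huniq ih

theorem terminal_blockReplace (h : IsSimulation D Γ e Γs) (hA : A ∈ Γ.terminal) :
    A.blockReplace (D.blocks e) ∈ Γs.terminal :=
  have hA' := h.producible_blockReplace hA.1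
  ⟨hA', h.frontier_blockReplace_eq_empty hA.1 hA' hA.2⟩

section Probability

variable [Fintype K] [Fintype T] [Nonempty T]

theorem hit_blockReplace_eq_step (h : IsSimulation D Γ e Γs) (hA : Γ.Producible A)
    (hne : (Γ.frontier A).Nonempty) (hX : Γs.frontier X = ∅) (C : Concentration (K × Role)) :
    Γs.hit C X (A.blockReplace (D.blocks e)) =
      Γ.step (Concentration.uniform T) (fun B => Γs.hit C X (B.blockReplace (D.blocks e))) A := by
  have hA' := h.producible_blockReplace hA
  obtain ⟨q, s, u, hgrow, hs, hu, ⟨hpair, hfrontier⟩ | ⟨v, hv, huv, huniq, hfrontier⟩⟩ :=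
    h.frontier_cases hA hne
  · rw [ChainData.hit_of_not_paired hgrow hX hs hu hpair hA', step_singleton hfrontier]
  · rw [ChainData.hit_of_paired hgrow hX hs hu hv huv huniq hA',
      step_pair (fun heq => huv (congrArg (fun x => e x.2) heq).symm) hfrontier]
    have hconc : (Concentration.uniform T).conc v = (Concentration.uniform T).conc u := rfl
    rw [hconc, div_add_self_eq ((Concentration.uniform T).conc_pos u)]

theorem hit_blockReplace (h : IsSimulation D Γ e Γs) (C : Concentration (K × Role))
    {Y : Assembly T} (hY : Y ∈ Γ.terminal) (hA : Γ.Producible A) :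
    Γ.hit (Concentration.uniform T) Y A =
      Γs.hit C (Y.blockReplace (D.blocks e)) (A.blockReplace (D.blocks e)) := by
  obtain ⟨n, hn⟩ : ∃ n, Y.dom.card + 1 ≤ A.dom.card + n := ⟨Y.dom.card + 1, by lia⟩
  induction n generalizing A with
  | zero =>
    rw [hit_eq_zero_of_card_lt (by lia), hit_eq_zero_of_card_lt]
    rw [card_dom_blockReplace, card_dom_blockReplace]
    lia
  | succ n ih =>
    rcases (Γ.frontier A).eq_empty_or_nonempty with hempty | hne
    · have hempty' := h.frontier_blockReplace_eq_empty hA (h.producible_blockReplace hA) hempty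
      by_cases hAY : A = Y
      · rw [← hAY, hit_self_of_frontier_eq_empty hempty, hit_self_of_frontier_eq_empty hempty']
      · rw [hit_of_frontier_eq_empty hempty hAY, hit_of_frontier_eq_empty hempty'
          ((D.blockReplace_injective e.injective).ne hAY)]
    · rw [hit_eq_step hY.2 hne,
        h.hit_blockReplace_eq_step hA hne (h.terminal_blockReplace hY).2]
      refine step_congr fun p t hf => ih (hA.attach hf) ?_
      rw [card_dom_place _ hf.1]
      lia

end Probability

theorem exists_terminal_of_terminal [Finite T] [Nonempty T] (h : IsSimulation D Γ e Γs)
    (hX : X ∈ Γs.terminal) :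
    ∃ A ∈ Γ.terminal, A.blockReplace (D.blocks e) = X := by
  by_contra! hcon
  have := Fintype.ofFinite T
  have := Fintype.ofEquiv T e
  have : Nonempty K := e.symm.nonempty
  refine hX.1.hit_seed_ne_zero (Concentration.uniform (K × Role)) ?_
  suffices ∀ n A, Γ.Producible A → X.dom.card + 1 ≤ A.dom.card * 20 + n →
      Γs.hit (Concentration.uniform (K × Role)) X (A.blockReplace (D.blocks e)) = 0 from
    h.seed_eq ▸ this (X.dom.card + 1) _ Producible.seed (by lia)
  intro n
  induction n with
  | zero =>
    intro A _ hn
    exact hit_eq_zero_of_card_lt (by rw [card_dom_blockReplace]; lia)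
  | succ n ih =>
    intro A hA hn
    rcases (Γ.frontier A).eq_empty_or_nonempty with hempty | hne
    · exact hit_of_frontier_eq_empty
        (h.frontier_blockReplace_eq_empty hA (h.producible_blockReplace hA) hempty)
        (hcon A ⟨hA, hempty⟩)
    · rw [h.hit_blockReplace_eq_step hA hne hX.2]
      refine step_const hA hne fun p t hf => ih _ (hA.attach hf) ?_
      rw [card_dom_place _ hf.1]
      lia

theorem robustlySimulates [Fintype K] [Fintype T] [Nonempty T] (h : IsSimulation D Γ e Γs) :
    Γs.RobustlySimulates Γ (Concentration.uniform T) 5 4 := by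
  refine ⟨D.blocks e, ⟨fun A hA => h.terminal_blockReplace hA,
    (D.blockReplace_injective e.injective).injOn,
    fun X hX => h.exists_terminal_of_terminal hX⟩, fun A hA C => ?_⟩
  rw [termProb_eq_hit, termProb_eq_hit, h.hit_blockReplace C hA Producible.seed, h.seed_eq]

end IsSimulation

section ChainData

variable [Nonempty T] (Γ) (e : T ≃ K)

open Classical in
/-- The data of the simulation of a system whose assemblies are rows that grow to the east: the
tile types with a given glue on the west side are represented by one of them. -/
noncomputable def chainData : ChainData K where
  rep k := e (Function.invFun (fun t => Γ.glue t .west) (Γ.glue (e.symm k) .west))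
  next k := if ∃ t, Γ.Joins (e.symm k) t then
    some (e (Function.invFun (fun t => Γ.glue t .west) (Γ.glue (e.symm k) .east))) else none

variable {Γ e} {s t : T}

theorem glue_rep (k : K) :
    Γ.glue (e.symm ((Γ.chainData e).rep k)) .west = Γ.glue (e.symm k) .west := by
  simp only [chainData, Equiv.symm_apply_apply]
  exact Function.invFun_eq (f := fun t => Γ.glue t .west) ⟨_, rfl⟩

theorem rep_eq_rep_iff :
    (Γ.chainData e).rep (e s) = (Γ.chainData e).rep (e t) ↔ Γ.glue s .west = Γ.glue t .west := by
  refine ⟨fun h => ?_, fun h => by simp [chainData, h]⟩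
  have hs := glue_rep (Γ := Γ) (e := e) (e s)
  rw [h, glue_rep] at hs
  simpa using hs.symm

theorem rep_rep (k : K) :
    (Γ.chainData e).rep ((Γ.chainData e).rep k) = (Γ.chainData e).rep k := by
  have h := rep_eq_rep_iff (Γ := Γ) (e := e) (s := e.symm ((Γ.chainData e).rep k))
    (t := e.symm k)
  simpa [glue_rep] using h

theorem next_eq_of_joins (h : Γ.Joins s t) :
    (Γ.chainData e).next (e s) = some ((Γ.chainData e).rep (e t)) := by
  have hex : ∃ t, Γ.Joins s t := ⟨t, h⟩
  simp [chainData, hex, h.1]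

theorem next_eq_none (h : ∀ t, ¬Γ.Joins s t) : (Γ.chainData e).next (e s) = none := by
  simp [chainData, h]

theorem next_eq_some_iff :
    (Γ.chainData e).next (e s) = some ((Γ.chainData e).rep (e t)) ↔ Γ.Joins s t := by
  refine ⟨fun h => ?_, next_eq_of_joins⟩
  by_cases hex : ∃ u, Γ.Joins s u
  · obtain ⟨u, hu⟩ := hex
    rw [next_eq_of_joins hu, Option.some_inj, rep_eq_rep_iff] at h
    exact ⟨hu.1.trans h, hu.2⟩
  · rw [next_eq_none (not_exists.1 hex)] at h
    exact absurd h (Option.some_ne_none _).symm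

theorem stable_blockReplace_chainData {A : Assembly T} {x₀ : ℤ} {q : ℤ × ℤ} {a : T}
    (hA : IsRow A x₀ q a s) (hstable : A.Stable Γ.glue Γ.str Γ.temperature) :
    (A.blockReplace ((Γ.chainData e).blocks e)).Stable (Γ.chainData e).glue glueStr 2 :=
  ChainData.stable_blockReplace hA fun _ _ _ hs ht =>
    next_eq_some_iff.2 (joins_of_stable hA hstable hs ht)

end ChainData

theorem exists_robustlySimulates_of_isEastward [Fintype T] [Nonempty T]
    (hΓ : Γ.IsUnidirectionalTwoChoiceLinear) (he : Γ.IsEastward) :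
    ∃ (T' G' : Type) (_ : Fintype T') (Γs : TileSystem T' G'),
      Fintype.card T' = 20 * Fintype.card T ∧
      Γs.RobustlySimulates Γ (Concentration.uniform T) 5 4 := by
  let e := Fintype.equivFin T
  let D := Γ.chainData e
  obtain ⟨x₀, q, a, s, hrow, -⟩ := id he
  let Γs : TileSystem (Fin (Fintype.card T) × Role) (ℕ × ℕ × Option (Fin (Fintype.card T))) :=
    { glue := D.glue
      str := glueStr
      seed := Γ.seed.blockReplace (D.blocks e)
      temperature := 2
      temperature_pos := two_pos
      seed_nonempty := by
        rw [← Finset.card_pos, card_dom_blockReplace]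
        exact Nat.mul_pos (Finset.card_pos.2 Γ.seed_nonempty) (by decide)
      seed_stable := stable_blockReplace_chainData hrow Γ.seed_stable }
  have hsim : IsSimulation D Γ e Γs :=
    { linear := hΓ
      eastward := he
      sim := ⟨rfl, rfl, rfl⟩
      seed_eq := rfl
      rep_rep := rep_rep
      next_eq_some_iff := fun _ _ => next_eq_some_iff
      next_eq_none := fun _ => next_eq_none }
  refine ⟨_, _, inferInstance, Γs, ?_, hsim.robustlySimulates⟩
  rw [Fintype.card_prod, Fintype.card_fin, mul_comm]
  rfl

end TileSystem

/-! ### Reflection -/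

/-- The reflection of the plane that exchanges east and west, as an action on cells. It maps the
cells of a block to the cells of a block as the column `-1` is the image of the column `0`. -/
def mirrorCell (p : ℤ × ℤ) : ℤ × ℤ := (-1 - p.1, p.2)

theorem mirrorCell_involutive : Function.Involutive mirrorCell := fun p => by simp [mirrorCell]

/-- The image of a side under the reflection that exchanges east and west. -/
def Side.mirror : Side → Side
  | .north => .north
  | .east => .west
  | .south => .south
  | .west => .east

theorem Side.mirror_involutive : Function.Involutive Side.mirror := fun d => by cases d <;> rfl

theorem Side.mirror_opp (d : Side) : d.opp.mirror = d.mirror.opp := by cases d <;> rfl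

theorem mirrorCell_add_vec (p : ℤ × ℤ) (d : Side) :
    mirrorCell (p + d.vec) = mirrorCell p + d.mirror.vec := by
  cases d <;> ext <;> simp [mirrorCell, Side.vec, Side.mirror] <;> ring

namespace Assembly

variable {T G : Type*} {A : Assembly T} {p : ℤ × ℤ} {glue : T → Side → G} {str : G → ℕ} {τ : ℕ}

/-- The image of an assembly under the reflection that exchanges east and west. The tiles
are moved without being reflected; it is `TileSystem.mirror` that exchanges their glues. -/
def mirror (A : Assembly T) : Assembly T where
  cell p := A.cell (mirrorCell p)
  finite_cells := A.finite_cells.preimage mirrorCell_involutive.injective.injOn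

theorem cell_mirror : A.mirror.cell p = A.cell (mirrorCell p) := rfl

theorem mirror_involutive : Function.Involutive (mirror : Assembly T → Assembly T) := fun A => by
  ext1
  funext p
  rw [cell_mirror, cell_mirror, mirrorCell_involutive]

theorem dom_mirror : A.mirror.dom = A.dom.image mirrorCell := by
  ext p
  rw [mem_dom, cell_mirror, ← mem_dom, ← mirrorCell_involutive.injective.mem_finset_image,
    mirrorCell_involutive]

variable (A) in
theorem mirror_place (p : ℤ × ℤ) (t : T) :
    (A.place p t).mirror = A.mirror.place (mirrorCell p) t := by
  ext1
  funext q
  rw [cell_mirror]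
  rcases eq_or_ne (mirrorCell q) p with rfl | h
  · rw [mirrorCell_involutive, cell_place_self, cell_place_self]
  · rw [cell_place_of_ne _ h, cell_place_of_ne _ (mirrorCell_involutive.eq_iff.not.1 h),
      cell_mirror]

theorem bond_mirror (p q : ℤ × ℤ) :
    A.mirror.bond glue str (mirrorCell p) (mirrorCell q) =
      A.bond (fun t d => glue t d.mirror) str p q := by
  classical
  unfold bond
  simp only [cell_mirror, mirrorCell_involutive p, mirrorCell_involutive q]
  rcases A.cell p with _ | a <;> rcases A.cell q with _ | b <;> simp only
  refine (Fintype.sum_equiv Side.mirror_involutive.toPerm _ _ fun d => ?_).symm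
  have hvec : mirrorCell q = mirrorCell p + d.mirror.vec ↔ q = p + d.vec := by
    rw [← mirrorCell_add_vec, mirrorCell_involutive.injective.eq_iff]
  simp only [← hvec, Side.mirror_opp]
  rfl

theorem cutWeight_mirror (S : Finset (ℤ × ℤ)) :
    A.mirror.cutWeight glue str (S.image mirrorCell) =
      A.cutWeight (fun t d => glue t d.mirror) str S := by
  have hinj := mirrorCell_involutive.injective
  simp only [cutWeight, dom_mirror, ← Finset.image_sdiff _ _ hinj, Finset.sum_image hinj.injOn,
    bond_mirror]

theorem stable_mirror :
    A.mirror.Stable glue str τ ↔ A.Stable (fun t d => glue t d.mirror) str τ := by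
  have hinj := mirrorCell_involutive.injective
  have himage : Function.Surjective (Finset.image mirrorCell) := fun S =>
    ⟨S.image mirrorCell, by rw [Finset.image_image, mirrorCell_involutive.comp_self,
      Finset.image_id]⟩
  rw [stable_iff_le_cutWeight, stable_iff_le_cutWeight, himage.forall]
  simp only [cutWeight_mirror, dom_mirror, Finset.image_subset_image_iff hinj,
    Finset.image_nonempty, (Finset.image_injective hinj).ne_iff]

theorem IsLine.mirror {n : ℕ} (h : A.IsLine n) : A.mirror.IsLine n := by
  obtain ⟨x, y, h⟩ := h
  refine ⟨-x - n, y, fun p => ?_⟩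
  rw [mem_dom, cell_mirror, ← mem_dom, h, mirrorCell]
  lia

theorem mirror_blockReplace {T' : Type*} {m n : ℕ} [NeZero m] [NeZero n]
    (R : T → Fin m → Fin n → T') (A : Assembly T) :
    (A.blockReplace R).mirror = A.mirror.blockReplace fun t i => R t i.rev := by
  ext1
  funext p
  have hm : (0 : ℤ) < m := by exact_mod_cast Nat.pos_of_neZero m
  have hlt := Int.emod_lt_of_pos p.1 hm
  have hnonneg := Int.emod_nonneg p.1 hm.ne'
  obtain ⟨hdiv, hmod⟩ : (-1 - p.1) / m = -1 - p.1 / m ∧ (-1 - p.1) % m = m - 1 - p.1 % m := by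
    rw [Int.ediv_emod_unique hm]
    exact ⟨by linarith [Int.emod_add_mul_ediv p.1 m], by lia, by lia⟩
  have hrev : Fin.ofNat m ((-1 - p.1) % m).toNat = (Fin.ofNat m (p.1 % m).toNat).rev := by
    ext
    rw [Fin.val_rev, Fin.val_ofNat, Fin.val_ofNat, Nat.mod_eq_of_lt (by lia),
      Nat.mod_eq_of_lt (by lia)]
    lia
  simp only [cell_mirror, blockReplace, mirrorCell, hdiv, hrev]

end Assembly

theorem IsRow.mirror {T : Type*} {A : Assembly T} {x₀ : ℤ} {q : ℤ × ℤ} {a s : T}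
    (hA : IsRow A x₀ q a s) : IsRow A.mirror (-q.1) (-x₀, q.2) s a where
  cell_ne p := by
    rw [cell_mirror, hA.cell_ne, mirrorCell]
    lia
  first := by
    rw [cell_mirror, ← hA.last]
    congr 2
    simp only [mirrorCell]
    lia
  last := by
    rw [cell_mirror, ← hA.first]
    congr 2
    simp only [mirrorCell]
    lia

namespace TileSystem

variable {T G : Type*}

/-- The image of a tile system under the reflection that exchanges east and west. -/
def mirror (Γ : TileSystem T G) : TileSystem T G where
  glue t d := Γ.glue t d.mirror
  str := Γ.str
  seed := Γ.seed.mirror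
  temperature := Γ.temperature
  temperature_pos := Γ.temperature_pos
  seed_nonempty := by
    rw [dom_mirror]
    exact Γ.seed_nonempty.image _
  seed_stable := by
    rw [stable_mirror]
    simp only [Side.mirror_involutive _]
    exact Γ.seed_stable

variable {Γ : TileSystem T G} {A : Assembly T}

theorem mirror_mirror : Γ.mirror.mirror = Γ := by
  simp only [mirror, Side.mirror_involutive _, Assembly.mirror_involutive _]

theorem mem_frontier_mirror {p : ℤ × ℤ} {t : T} :
    (p, t) ∈ Γ.mirror.frontier A ↔ (mirrorCell p, t) ∈ Γ.frontier A.mirror := by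
  refine and_congr (by simp only [cell_mirror, mirrorCell_involutive p]) ?_
  rw [← mirror_place, stable_mirror]
  rfl

theorem frontier_mirror :
    Γ.mirror.frontier A = Prod.map mirrorCell id '' Γ.frontier A.mirror := by
  rw [(mirrorCell_involutive.prodMap fun _ => rfl).image_eq_preimage_symm]
  ext ⟨p, t⟩
  exact mem_frontier_mirror

theorem Producible.mirror (h : Γ.Producible A) : Γ.mirror.Producible A.mirror := by
  induction h with
  | seed => exact Producible.seed
  | @attach A p t _ hf ih =>
    rw [mirror_place]
    refine ih.attach (mem_frontier_mirror.2 ?_)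
    rwa [mirrorCell_involutive, Assembly.mirror_involutive]

theorem producible_mirror : Γ.mirror.Producible A ↔ Γ.Producible A.mirror := by
  refine ⟨fun h => ?_, fun h => ?_⟩
  · simpa only [mirror_mirror] using h.mirror
  · simpa only [Assembly.mirror_involutive A] using h.mirror

theorem mem_terminal_mirror : A ∈ Γ.mirror.terminal ↔ A.mirror ∈ Γ.terminal := by
  refine and_congr producible_mirror ?_
  rw [frontier_mirror, Set.image_eq_empty]

theorem bijOn_mirror_terminal : Set.BijOn Assembly.mirror Γ.terminal Γ.mirror.terminal :=
  Set.InvOn.bijOn (f' := Assembly.mirror)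
    ⟨fun A _ => A.mirror_involutive, fun A _ => A.mirror_involutive⟩
    (fun A hA => mem_terminal_mirror.2 (A.mirror_involutive.symm ▸ hA))
    (fun _ hA => mem_terminal_mirror.1 hA)

theorem IsUnidirectionalTwoChoiceLinear.mirror (hΓ : Γ.IsUnidirectionalTwoChoiceLinear) :
    Γ.mirror.IsUnidirectionalTwoChoiceLinear where
  extensible A hA := by
    rw [frontier_mirror, Set.image_image]
    simp only [Prod.map_fst]
    rw [← Set.image_image mirrorCell Prod.fst]
    exact (Set.encard_image_le _ _).trans (hΓ.extensible _ (producible_mirror.1 hA))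
  two_choice A hA := by
    rw [frontier_mirror]
    exact (Set.encard_image_le _ _).trans (hΓ.two_choice _ (producible_mirror.1 hA))
  linear A hA := by
    obtain ⟨n, hn⟩ := hΓ.linear _ (producible_mirror.1 hA)
    exact ⟨n, A.mirror_involutive ▸ hn.mirror⟩

section Probability

variable [Fintype T] {P : Concentration T}

theorem step_mirror (f : Assembly T → ℝ≥0∞) :
    Γ.mirror.step P f A = Γ.step P (fun B => f B.mirror) A.mirror := by
  have hinj : Function.Injective (Prod.map mirrorCell (id : T → T)) :=
    mirrorCell_involutive.injective.prodMap Function.injective_id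
  unfold step
  rw [frontier_mirror,
    tsum_image (fun b : (ℤ × ℤ) × T => (P.conc b.2 : ℝ≥0∞) * f (A.place b.1 b.2)) hinj.injOn,
    tsum_image (fun b : (ℤ × ℤ) × T => (P.conc b.2 : ℝ≥0∞)) hinj.injOn]
  simp only [mirror_place, Assembly.mirror_involutive A, Prod.map_fst, Prod.map_snd, id]

theorem walk_mirror (X : Assembly T) (n : ℕ) :
    Γ.mirror.walk P X n A = Γ.walk P X.mirror n A.mirror := by
  induction n generalizing A with
  | zero =>
    unfold walk
    congr 1
    rw [Assembly.mirror_involutive.injective.eq_iff]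
  | succ n ih => simp only [walk, step_mirror, ih, Assembly.mirror_involutive _]

theorem termProb_mirror (X : Assembly T) : Γ.mirror.termProb P X = Γ.termProb P X.mirror := by
  rw [termProb_eq_hit, termProb_eq_hit]
  refine tsum_congr fun n => (walk_mirror X n).trans ?_
  rw [mirror, Assembly.mirror_involutive]

theorem RobustlySimulates.mirror {T₀ G₀ : Type*} [Fintype T₀] {Γ₀ : TileSystem T₀ G₀}
    {P₀ : Concentration T₀} {m n : ℕ} [NeZero m] [NeZero n]
    (h : Γ.RobustlySimulates Γ₀.mirror P₀ m n) : Γ.mirror.RobustlySimulates Γ₀ P₀ m n := by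
  obtain ⟨R, hbij, hprob⟩ := h
  have hR : blockReplace (fun t i => R t i.rev) =
      Assembly.mirror ∘ blockReplace R ∘ Assembly.mirror := by
    funext A
    simp only [Function.comp_apply, mirror_blockReplace, Assembly.mirror_involutive A]
  refine ⟨fun t i => R t i.rev, ?_, fun A hA C => ?_⟩
  · rw [hR]
    exact bijOn_mirror_terminal.comp (hbij.comp bijOn_mirror_terminal)
  · rw [hR, termProb_mirror, Function.comp_apply, Function.comp_apply,
      Assembly.mirror_involutive, ← hprob _ (bijOn_mirror_terminal.mapsTo hA), termProb_mirror,
      Assembly.mirror_involutive]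

end Probability

section Eastward

variable {x₀ : ℤ} {q : ℤ × ℤ} {a s t u : T}

theorem joins_mirror : Γ.mirror.Joins s t ↔ Γ.Joins t s := by
  change Γ.glue s .west = Γ.glue t .east ∧ Γ.temperature ≤ Γ.str (Γ.glue s .west) ↔ _
  rw [eq_comm]
  exact and_congr_right fun h => by rw [h]

theorem not_joins_of_joins (hΓ : Γ.IsUnidirectionalTwoChoiceLinear) (hA : Γ.Producible A)
    (hrow : IsRow A x₀ q a s) (hu : Γ.Joins u a) : ¬Γ.Joins s t := by
  intro ht
  have heast : (q, t) ∈ Γ.frontier A := by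
    rw [hA.mem_frontier_iff, hrow.attachWeight_east, temperature_le_bondWith_west]
    exact ⟨hrow.cell_eq_none (by simp), ht⟩
  have hwest : ((x₀ - 1, q.2), u) ∈ Γ.frontier A := by
    rw [hA.mem_frontier_iff, hrow.attachWeight_west, temperature_le_bondWith_east]
    exact ⟨hrow.cell_eq_none (by simp), hu⟩
  have heq : q = (x₀ - 1, q.2) :=
    Set.encard_le_one_iff.1 (hΓ.extensible A hA) _ _ ⟨_, heast, rfl⟩ ⟨_, hwest, rfl⟩
  have hlt := hrow.lt
  rw [heq] at hlt
  exact (sub_one_lt x₀).not_gt hlt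

theorem isEastward_or_isEastward_mirror (hΓ : Γ.IsUnidirectionalTwoChoiceLinear) :
    Γ.IsEastward ∨ Γ.mirror.IsEastward := by
  obtain ⟨n, hn⟩ := hΓ.linear _ Producible.seed
  obtain ⟨x₀, q, a, s, hrow⟩ := exists_isRow Γ.seed_nonempty hn
  by_cases ha : ∃ u, Γ.Joins u a
  · obtain ⟨u, hu⟩ := ha
    exact Or.inr ⟨_, _, _, _, hrow.mirror, fun t =>
      mt joins_mirror.1 (not_joins_of_joins hΓ Producible.seed hrow hu)⟩
  · exact Or.inl ⟨x₀, q, a, s, hrow, not_exists.1 ha⟩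

end Eastward

end TileSystem

end ATAM

theorem mainTheorem3_general {T G : Type*} [Fintype T] [Nonempty T] (Γ : ATAM.TileSystem T G)
    (hΓ : Γ.IsUnidirectionalTwoChoiceLinear) :
    ∃ (T' G' : Type) (_ : Fintype T') (Γs : ATAM.TileSystem T' G'),
      Fintype.card T' = 20 * Fintype.card T ∧
      Γs.RobustlySimulates Γ (ATAM.Concentration.uniform T) 5 4 := by
  rcases ATAM.TileSystem.isEastward_or_isEastward_mirror hΓ with h | h
  · exact ATAM.TileSystem.exists_robustlySimulates_of_isEastward hΓ h
  · obtain ⟨T', G', _, Γs, hcard, hsim⟩ :=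
      ATAM.TileSystem.exists_robustlySimulates_of_isEastward hΓ.mirror h
    exact ⟨T', G', _, Γs.mirror, hcard, hsim.mirror⟩

theorem mainTheorem3 {T G : Type*} [Fintype T] [Nonempty T] (Γ : ATAM.TileSystem T G)
    (hτ : Γ.temperature = 2) (hΓ : Γ.IsUnidirectionalTwoChoiceLinear) :
    ∃ (T' G' : Type) (_ : Fintype T') (Γs : ATAM.TileSystem T' G'),
      Fintype.card T' = 20 * Fintype.card T ∧
      Γs.RobustlySimulates Γ (ATAM.Concentration.uniform T) 5 4 :=
  mainTheorem3_general Γ hΓ
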